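/- **Theorem 3.1 (General LLN).** Let $X$ be a Polish space with its Borel $\sigma$-field and let $\mathcal N\subset\mathbb Z^d$ be finite, with $\mathbf 0\in\mathcal N$ and $-\mathcal N=\mathcal N$. Write $\mathcal N_v=v+\mathcal N$, and for $A\subset\mathbb Z^d$ write $\mathcal N_A=\bigcup_{v\in A}\mathcal N_v$, $\partial_{\rm ext}A=\mathcal N_A\setminus A$, $A^\circ=\mathbb Z^d\setminus\mathcal N_{\mathbb Z^d\setminus A}$. For $x\in X^{\mathbb Z^d}$ let $x|_{\mathcal N}$ be its restriction to $\mathcal N$, and let $L_v(x|_{\mathcal N_v})\in X^{\mathcal N}$ be the pattern $w\mapsto x(v+w)$, $w\in\mathcal N$. Let $\alpha^*(y,dz)$ be a measurable kernel on $X^{\mathcal N}$ whose total mass is bounded uniformly in $y$. For bounded measurable $f:X^{\mathbb Z^d}\to\mathbb R$ depending on finitely many coordinates and $W\subset\mathbb Z^d$ put $$G^Wf(x)=\sum_{v\in W}\int_{X^{\mathcal N}}\bigl(f(x^{v,y})-f(x)\bigr)\,\alpha^*\bigl(L_v(x|_{\mathcal N_v}),dy\bigr),$$ where $x^{v,y}(w)=y(w-v)$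 for $w\in\mathcal N_v$ and $x^{v,y}(w)=x(w)$ otherwise. Let $\nu$ be a probability measure on $X$. For each $A$ in the collection $\mathcal B$ of non-empty finite subsets of $\mathbb Z^d$ let $(\xi^{A,\nu}_t)_{t\ge0}$, and let also $(\xi^\nu_t)_{t\ge0}$, be $X^{\mathbb Z^d}$-valued Markov processes with right-continuous paths with left limits, whose transition semigroups $(P_t)$ satisfy $t^{-1}(P_tf-f)\to Gf$ uniformly as $t\downarrow0$ for all such $f$, with $G=G^A$ and $G=G^{\mathbb Z^d}$ respectively, and whose initial states at the sites of $\mathbb Z^d$ are independent with common law $\nu$. Let $H:X^{\mathcal N}\to\mathbb R$ be measurable, $S_H^A(x)=\sum_{v\in A}H(L_v(x|_{\mathcal N_v}))$, and let $\tau>0$. Suppose that for some $\gamma>1$ $$\sup_{A\in\mathcal B}E\bigl[|H(\xi_\tau^{A,\nu}|_{\mathcal N})|^\gamma\bigr]<\infty .$$ Let $(A_n)$ be a sequence in $\mathcal B$ such that $|\partial_{\rm ext}A_n|/|A_n|\to0$ as $n\to\infty$ and $(\mathcal N_{A_n})^\circ=A_n$ for all $n$; if $\mathcal N=\{\mathbf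 0\}$, suppose also that $|A_n|\to\infty$. Then $H(\xi_\tau^\nu|_{\mathcal N})$ and all $S_H^{A_n}(\xi_\tau^{A_n,\nu})$ are integrable and, as $n\to\infty$, $$|A_n|^{-1}S_H^{A_n}(\xi_\tau^{A_n,\nu})\xrightarrow{L^1}E\,H(\xi_\tau^\nu|_{\mathcal N}).$$ -/

import Mathlib

open MeasureTheory ProbabilityTheory Filter Topology
open scoped NNReal ENNReal

namespace IPS

section Markov

variable {E : Type*} [MeasurableSpace E]

/-- A Markovian family of transition distributions on `E`: probability kernels with
`μ 0 x = δ_x` and the Chapman-Kolmogorov relation `∫ μ_t(y, ·) μ_s(x, dy) = μ_{s+t}(x, ·)`. -/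
structure IsMarkovianFamily (μ : ℝ≥0 → Kernel E E) : Prop where
  markov : ∀ t, IsMarkovKernel (μ t)
  zero : μ 0 = Kernel.id
  add : ∀ s t, μ (s + t) = μ t ∘ₖ μ s

/-- The semigroup of operators `P_t f (x) = ∫ f(y) μ_t(x, dy)`. -/
noncomputable def semigroup (μ : ℝ≥0 → Kernel E E) (t : ℝ≥0) (f : E → ℝ) (x : E) : ℝ :=
  ∫ y, f y ∂(μ t x)

/-- On the class `C` of functions, the generator of the semigroup is `G`:
for each `f ∈ C`, `t⁻¹ (P_t f - f) → G f` as `t ↓ 0`, uniformly on `E`. -/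
def HasGeneratorOn (μ : ℝ≥0 → Kernel E E) (C : Set (E → ℝ)) (G : (E → ℝ) → E → ℝ) : Prop :=
  ∀ f ∈ C, TendstoUniformly
    (fun (t : ℝ≥0) (x : E) => (t : ℝ)⁻¹ * (semigroup μ t f x - f x)) (G f) (𝓝[>] 0)

/-- `ξ` is, under `P`, a Markov process with transition distributions `μ`: all its sample paths
are right-continuous with left limits and, for some filtration to which it is adapted,
`P[ξ_{s+t} ∈ B | 𝒢_s] = μ_t(ξ_s, B)` almost surely. -/
structure IsMarkovProcess [TopologicalSpace E] {Ω : Type*} [mΩ : MeasurableSpace Ω]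
    (P : Measure Ω) (μ : ℝ≥0 → Kernel E E) (ξ : ℝ≥0 → Ω → E) : Prop where
  right_continuous : ∀ ω t, ContinuousWithinAt (fun s => ξ s ω) (Set.Ici t) t
  left_limits : ∀ ω t, ∃ l, Tendsto (fun s => ξ s ω) (𝓝[<] t) (𝓝 l)
  markov : ∃ 𝒢 : Filtration ℝ≥0 mΩ, (∀ t, Measurable[𝒢 t] (ξ t)) ∧
    ∀ s t, ∀ B : Set E, MeasurableSet B →
      P⟦ξ (s + t) ⁻¹' B | 𝒢 s⟧ =ᵐ[P] fun ω => (μ t (ξ s ω)).real B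

end Markov

/-- The lattice `ℤ^d`. -/
abbrev Lattice (d : ℕ) : Type := Fin d → ℤ

section Geometry

variable {d : ℕ}

/-- `𝒩_v = v + 𝒩`. -/
def nbhd (N : Finset (Lattice d)) (v : Lattice d) : Set (Lattice d) :=
  (fun w => v + w) '' (N : Set (Lattice d))

/-- `𝒩_A = ⋃_{v ∈ A} 𝒩_v`. -/
def nbhdSet (N : Finset (Lattice d)) (A : Set (Lattice d)) : Set (Lattice d) :=
  ⋃ v ∈ A, nbhd N v

/-- `∂_ext A = 𝒩_A \ A`. -/
def extBoundary (N : Finset (Lattice d)) (A : Set (Lattice d)) : Set (Lattice d) :=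
  nbhdSet N A \ A

/-- `A° = ℤ^d \ 𝒩_{A^c}`. -/
def inner (N : Finset (Lattice d)) (A : Set (Lattice d)) : Set (Lattice d) :=
  (nbhdSet N Aᶜ)ᶜ

end Geometry

section Dynamics

variable {d : ℕ} {X : Type*}

/-- `L_v (x|_{𝒩_v})`: the configuration that `x` shows in `v + 𝒩`, moved to `𝒩`. -/
def window (N : Finset (Lattice d)) (v : Lattice d) (x : Lattice d → X) : N → X :=
  fun w => x (w + v)

/-- The configuration `x |v| (L_v⁻¹ y)`: it shows the pattern `y`, moved from `𝒩` to `v + 𝒩`,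
inside `v + 𝒩`, and agrees with `x` outside `v + 𝒩`. -/
def glue (N : Finset (Lattice d)) (v : Lattice d) (x : Lattice d → X) (y : N → X) :
    Lattice d → X :=
  fun w => if h : w - v ∈ N then y ⟨w - v, h⟩ else x w

variable [MeasurableSpace X]

/-- The class of bounded measurable functions on `X^{ℤ^d}` which depend only on finitely many
coordinates. -/
def localFunctions (d : ℕ) (X : Type*) [MeasurableSpace X] : Set ((Lattice d → X) → ℝ) :=
  {f | Measurable f ∧ (∃ C : ℝ, ∀ x, |f x| ≤ C) ∧
    ∃ S : Finset (Lattice d), DependsOn f (S : Set (Lattice d))}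

/-- The generator `G_v` of the jumps at `v`. The jump rate kernel `α` on `X^𝒩` is shifted to
`X^{𝒩_v}`: in state `x`, the pattern in `v + 𝒩` is replaced by (the shift of) `y` at rate
`α(L_v (x|_{𝒩_v}), dy)`. -/
noncomputable def siteGenerator (N : Finset (Lattice d)) (α : Kernel (N → X) (N → X))
    (v : Lattice d) (f : (Lattice d → X) → ℝ) (x : Lattice d → X) : ℝ :=
  ∫ y, (f (glue N v x y) - f x) ∂(α (window N v x))

/-- `G^W = ∑_{v ∈ W} G_v`. On functions of finitely many coordinates only finitely many terms
are nonzero. -/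
noncomputable def generator (N : Finset (Lattice d)) (α : Kernel (N → X) (N → X))
    (W : Set (Lattice d)) (f : (Lattice d → X) → ℝ) (x : Lattice d → X) : ℝ :=
  ∑ᶠ v ∈ W, siteGenerator N α v f x

/-- `ξ` is, under `P`, a realization of the Markov process on `X^{ℤ^d}` with generator `G^W`
whose initial states at the sites are independent with common distribution `ν`. -/
structure IsRealization [TopologicalSpace X] (N : Finset (Lattice d))
    (α : Kernel (N → X) (N → X)) (W : Set (Lattice d)) (ν : Measure X)
    {Ω : Type*} [MeasurableSpace Ω] (P : Measure Ω) (ξ : ℝ≥0 → Ω → Lattice d → X) : Prop where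
  process : ∃ μ : ℝ≥0 → Kernel (Lattice d → X) (Lattice d → X),
    IsMarkovianFamily μ ∧ HasGeneratorOn μ (localFunctions d X) (generator N α W) ∧
      IsMarkovProcess P μ ξ
  initial_indep : iIndepFun (fun (v : Lattice d) (ω : Ω) => ξ 0 ω v) P
  initial_law : ∀ v, P.map (fun ω => ξ 0 ω v) = ν

/-- The stationary additive set function `S_H^A (x) = ∑_{v ∈ A} H (L_v (x|_{𝒩_v}))`. -/
def additive (N : Finset (Lattice d)) (H : (N → X) → ℝ) (A : Finset (Lattice d))
    (x : Lattice d → X) : ℝ :=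
  ∑ v ∈ A, H (window N v x)

end Dynamics

end IPS

/-! At time `τ`, distant windows are nearly independent, and a window deep inside `A` has nearly the
law of the window at the origin in the infinite system. After truncation of `H`, the second moment
of the centred average therefore tends to zero.

Both facts come from the exponential series of the generator. If `f` depends on at most `s` sites
and `|f| ≤ B`, then `G f` is a sum of at most `s |N|` jump terms, each bounded by `2cB` and
depending on at most `|N|` additional sites. Hence `t^n/n! |G^n f| ≤ B 2^s 2^(-n)` for small `t`,
uniformly in `W` (`mul_abs_genEnd_pow_le`). By Taylor's formula (`abs_semigroup_sub_expSum_le`),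
partial sums of the series approximate `P_t f` geometrically fast. They have finite range, see `W`
only near the support of `f`, and respect translations. The Leibniz rule for functions with distant
supports makes them nearly multiplicative. Composing short steps reaches time `τ`
(`exists_stepProd`), and integration over the product initial law gives `E[f g] ≈ m_W(f) m_W(g)`
(`exists_approx_expectation`).

With `g = 1` this yields translation covariance of the laws (`IsLawAt.map_window_eq`) and carries
the moment bound over to the infinite system (`lintegral_le_of_isLawAt_univ`). With two translates
of one function it bounds covariances; pairs of close sites and sites near the boundary are a
negligible fraction (`exists_integral_sq_sum_le`). The moment of order `γ > 1` makes the truncation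
error uniformly small. -/

open scoped Pointwise

namespace IPS

/-! ### Neighbourhoods of finite sets of sites. -/

section Thicken

variable {d : ℕ}

/-- The set of the sites that can be reached from `S` in `k` steps from `N`. -/
def thicken (N : Finset (Lattice d)) (k : ℕ) (S : Finset (Lattice d)) : Finset (Lattice d) :=
  (· + N)^[k] S

variable {N : Finset (Lattice d)}

@[simp] theorem thicken_zero (S : Finset (Lattice d)) : thicken N 0 S = S := rfl

theorem thicken_succ (k : ℕ) (S : Finset (Lattice d)) :
    thicken N (k + 1) S = thicken N k (S + N) := rfl

theorem thicken_succ' (k : ℕ) (S : Finset (Lattice d)) :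
    thicken N (k + 1) S = thicken N k S + N :=
  Function.iterate_succ_apply' _ _ _

theorem thicken_add (j k : ℕ) (S : Finset (Lattice d)) :
    thicken N (j + k) S = thicken N j (thicken N k S) :=
  Function.iterate_add_apply _ _ _ _

theorem thicken_mono (k : ℕ) {S T : Finset (Lattice d)} (h : S ⊆ T) :
    thicken N k S ⊆ thicken N k T := by
  induction k generalizing S T with
  | zero => exact h
  | succ k ih => exact ih (Finset.add_subset_add_right h)

theorem subset_thicken (hN0 : 0 ∈ N) (k : ℕ) (S : Finset (Lattice d)) : S ⊆ thicken N k S := by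
  induction k generalizing S with
  | zero => exact subset_rfl
  | succ k ih =>
    have h : S ⊆ S + N := fun w hw => Finset.mem_add.2 ⟨w, hw, 0, hN0, add_zero w⟩
    exact h.trans (ih _)

theorem thicken_mono_left (hN0 : 0 ∈ N) {j k : ℕ} (h : j ≤ k) (S : Finset (Lattice d)) :
    thicken N j S ⊆ thicken N k S := by
  obtain ⟨i, rfl⟩ := Nat.exists_eq_add_of_le h
  rw [thicken_add]
  exact thicken_mono _ (subset_thicken hN0 _ _)

@[simp] theorem thicken_empty (k : ℕ) : thicken N k ∅ = ∅ := by
  induction k with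
  | zero => rfl
  | succ k ih => rwa [thicken_succ, Finset.empty_add]

theorem thicken_add_right (k : ℕ) (S T : Finset (Lattice d)) :
    thicken N k (S + T) = thicken N k S + T := by
  induction k generalizing S with
  | zero => rfl
  | succ k ih => rw [thicken_succ, thicken_succ, ← ih, add_right_comm]

theorem card_thicken_le (k : ℕ) (S : Finset (Lattice d)) :
    (thicken N k S).card ≤ S.card * N.card ^ k := by
  induction k with
  | zero => simp
  | succ k ih =>
    rw [thicken_succ', pow_succ, ← mul_assoc]
    exact (Finset.card_add_le).trans (Nat.mul_le_mul_right _ ih)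

theorem mem_thicken_comm (hN : ∀ w ∈ N, -w ∈ N) {k : ℕ} {u v : Lattice d}
    (h : u ∈ thicken N k {v}) : v ∈ thicken N k {u} := by
  induction k generalizing u with
  | zero => simpa [eq_comm] using h
  | succ k ih =>
    rw [thicken_succ', Finset.mem_add] at h
    obtain ⟨z, hz, w, hw, rfl⟩ := h
    rw [thicken_succ]
    refine thicken_mono k ?_ (ih hz)
    simpa using Finset.mem_add.2 ⟨z + w, by simp, -w, hN w hw, by simp⟩

theorem mem_thicken_trans {j k : ℕ} {u v w : Lattice d}
    (h : u ∈ thicken N j {v}) (h' : v ∈ thicken N k {w}) : u ∈ thicken N (j + k) {w} := by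
  rw [thicken_add]
  exact thicken_mono j (by simpa using h') h

end Thicken

/-! ### The algebra of local functions. -/

section LocalAlgebra

variable {d : ℕ} {X : Type*} [MeasurableSpace X]

/-- The algebra of the bounded measurable functions of finitely many coordinates. -/
def localAlgebra (d : ℕ) (X : Type*) [MeasurableSpace X] :
    Subalgebra ℝ ((Lattice d → X) → ℝ) where
  carrier := localFunctions d X
  mul_mem' := by
    rintro f g ⟨hf, ⟨B, hB⟩, S, hS⟩ ⟨hg, ⟨C, hC⟩, T, hT⟩
    refine ⟨hf.mul hg, ⟨B * C, fun x => ?_⟩, S ∪ T, fun x y h => ?_⟩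
    · rw [Pi.mul_apply, abs_mul]
      exact mul_le_mul (hB x) (hC x) (abs_nonneg _) ((abs_nonneg _).trans (hB x))
    · rw [Pi.mul_apply, Pi.mul_apply, hS fun i hi => h i (by simp_all),
        hT fun i hi => h i (by simp_all)]
  add_mem' := by
    rintro f g ⟨hf, ⟨B, hB⟩, S, hS⟩ ⟨hg, ⟨C, hC⟩, T, hT⟩
    refine ⟨hf.add hg, ⟨B + C, fun x => ?_⟩, S ∪ T, fun x y h => ?_⟩
    · exact (abs_add_le _ _).trans (add_le_add (hB x) (hC x))
    · rw [Pi.add_apply, Pi.add_apply, hS fun i hi => h i (by simp_all),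
        hT fun i hi => h i (by simp_all)]
  algebraMap_mem' r := ⟨measurable_const, ⟨|r|, fun _ => le_rfl⟩, ∅, fun _ _ _ => rfl⟩

instance : CoeFun (localAlgebra d X) fun _ => (Lattice d → X) → ℝ := ⟨Subtype.val⟩

namespace localAlgebra

theorem measurable (f : localAlgebra d X) : Measurable f := f.2.1

theorem exists_bound (f : localAlgebra d X) : ∃ B : ℝ, ∀ x, |f x| ≤ B := f.2.2.1

theorem integrable (f : localAlgebra d X) (μ : Measure (Lattice d → X)) [IsFiniteMeasure μ] :
    Integrable f μ := by
  obtain ⟨B, hB⟩ := localAlgebra.exists_bound f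
  exact .of_bound (localAlgebra.measurable f).aestronglyMeasurable B (ae_of_all _ hB)

theorem sum_apply {ι : Type*} (s : Finset ι) (f : ι → localAlgebra d X) (x : Lattice d → X) :
    (∑ i ∈ s, f i : localAlgebra d X) x = ∑ i ∈ s, f i x := by
  rw [AddSubmonoidClass.coe_finsetSum, Finset.sum_apply]

end localAlgebra

end LocalAlgebra

/-! ### Jumps at a single site. -/

section SiteGenerator

variable {d : ℕ} {X : Type*} {N : Finset (Lattice d)}

theorem glue_apply_of_notMem (hN : ∀ w ∈ N, -w ∈ N) {S : Finset (Lattice d)} {v w : Lattice d}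
    (hv : v ∉ S + N) (hw : w ∈ S) (x : Lattice d → X) (y : N → X) : glue N v x y w = x w := by
  refine dif_neg fun h => hv ?_
  exact Finset.mem_add.2 ⟨w, hw, -(w - v), hN _ h, by abel⟩

theorem apply_glue_of_notMem (hN : ∀ w ∈ N, -w ∈ N) {S : Finset (Lattice d)} {v : Lattice d}
    (hv : v ∉ S + N) {f : (Lattice d → X) → ℝ} (hf : DependsOn f (S : Set (Lattice d)))
    (x : Lattice d → X) (y : N → X) : f (glue N v x y) = f x :=
  hf fun _ hw => glue_apply_of_notMem hN hv hw x y

variable [MeasurableSpace X]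

theorem measurable_window (v : Lattice d) :
    Measurable (window N v : (Lattice d → X) → N → X) :=
  measurable_pi_lambda _ fun _ => measurable_pi_apply _

theorem measurable_glue (v : Lattice d) :
    Measurable fun p : (Lattice d → X) × (N → X) => glue N v p.1 p.2 := by
  refine measurable_pi_lambda _ fun w => ?_
  by_cases h : w - v ∈ N
  · simp only [glue, h, dif_pos]
    exact (measurable_pi_apply _).comp measurable_snd
  · simp only [glue, h, dif_neg, not_false_eq_true]
    exact (measurable_pi_apply _).comp measurable_fst

variable {α : Kernel (N → X) (N → X)}

theorem siteGenerator_of_notMem (hN : ∀ w ∈ N, -w ∈ N) {S : Finset (Lattice d)} {v : Lattice d}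
    (hv : v ∉ S + N) {f : (Lattice d → X) → ℝ} (hf : DependsOn f (S : Set (Lattice d))) :
    siteGenerator N α v f = 0 := by
  ext x
  simp [siteGenerator, apply_glue_of_notMem hN hv hf]

-- The larger index set `V` lets the sums for `f`, `g` and `f * g` run over the same sites.
open Classical in
theorem generator_eq_sum (hN : ∀ w ∈ N, -w ∈ N) (W : Set (Lattice d)) {S V : Finset (Lattice d)}
    (hV : S + N ⊆ V) {f : (Lattice d → X) → ℝ} (hf : DependsOn f (S : Set (Lattice d))) :
    generator N α W f = ∑ v ∈ V with v ∈ W, siteGenerator N α v f := by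
  ext x
  rw [generator, Finset.sum_apply]
  refine finsum_mem_eq_sum_of_inter_support_eq _ ?_
  ext v
  simp only [Set.mem_inter_iff, Function.mem_support, Finset.coe_filter, Set.mem_ofPred_eq]
  refine ⟨fun h => ⟨⟨hV ?_, h.1⟩, h.2⟩, fun h => ⟨h.1.2, h.2⟩⟩
  by_contra hv
  exact h.2 (by rw [siteGenerator_of_notMem hN hv hf]; rfl)

theorem dependsOn_siteGenerator {S : Finset (Lattice d)} (v : Lattice d)
    {f : (Lattice d → X) → ℝ} (hf : DependsOn f (S : Set (Lattice d))) :
    DependsOn (siteGenerator N α v f) ((S ∪ N.image (· + v) : Finset (Lattice d)) :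
      Set (Lattice d)) := by
  intro x x' h
  have hw : window N v x = window N v x' := by
    ext w
    exact h _ (by simp)
  have hg : ∀ y, f (glue N v x y) = f (glue N v x' y) := by
    refine fun y => hf fun w hw => ?_
    simp only [glue]
    split_ifs
    · rfl
    · exact h w (by simp at hw; simp [hw])
  have hf' : f x = f x' := hf fun w hw => h w (by simp at hw; simp [hw])
  simp only [siteGenerator, hw, hg, hf']

theorem measurable_siteGenerator [IsFiniteKernel α] (v : Lattice d) {f : (Lattice d → X) → ℝ}
    (hf : Measurable f) : Measurable (siteGenerator N α v f) := by
  have h : StronglyMeasurable fun p : (Lattice d → X) × (N → X) =>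
      f (glue N v p.1 p.2) - f p.1 :=
    ((hf.comp (measurable_glue v)).sub (hf.comp measurable_fst)).stronglyMeasurable
  exact (h.integral_kernel_prod_right' (κ := α.comap _ (measurable_window v))).measurable

theorem abs_siteGenerator_le {c : ℝ≥0} (hα : ∀ x, α x Set.univ ≤ c) (v : Lattice d)
    {f : (Lattice d → X) → ℝ} {B : ℝ} (hB : ∀ x, |f x| ≤ B) (x : Lattice d → X) :
    |siteGenerator N α v f x| ≤ 2 * c * B := by
  have hB0 : 0 ≤ B := (abs_nonneg _).trans (hB x)
  have : IsFiniteMeasure (α (window N v x)) := ⟨(hα _).trans_lt ENNReal.coe_lt_top⟩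
  have h1 : ‖siteGenerator N α v f x‖ ≤ (2 * B) * (α (window N v x)).real Set.univ := by
    refine norm_integral_le_of_norm_le_const (ae_of_all _ fun y => ?_)
    rw [Real.norm_eq_abs]
    refine (abs_sub _ _).trans ?_
    linarith [hB (glue N v x y), hB x]
  have h2 : (α (window N v x)).real Set.univ ≤ c :=
    ENNReal.toReal_le_coe_of_le_coe (hα _)
  calc _ ≤ (2 * B) * (α (window N v x)).real Set.univ := h1
    _ ≤ (2 * B) * c := by gcongr
    _ = _ := by ring

/-- The generator of the jumps at `v` as an endomorphism of the algebra of local functions. -/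
noncomputable def siteEnd (N : Finset (Lattice d)) (α : Kernel (N → X) (N → X))
    [IsFiniteKernel α] (v : Lattice d) : Module.End ℝ (localAlgebra d X) where
  toFun f := ⟨siteGenerator N α v f, by
    obtain ⟨hf, ⟨B, hB⟩, S, hS⟩ := f.2
    exact ⟨measurable_siteGenerator v hf,
      ⟨_, abs_siteGenerator_le (c := (α.bound).toNNReal) (fun x => by
        rw [ENNReal.coe_toNNReal (Kernel.bound_ne_top α)]
        exact Kernel.measure_le_bound α x _) v hB⟩,
      _, dependsOn_siteGenerator v hS⟩⟩
  map_add' f g := by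
    ext x
    have hi (f : localAlgebra d X) : Integrable (fun y => f (glue N v x y) - f x)
        (α (window N v x)) := by
      obtain ⟨B, hB⟩ := localAlgebra.exists_bound f
      have hm : Measurable fun y => f (glue N v x y) :=
        (localAlgebra.measurable f).comp ((measurable_glue v).comp measurable_prodMk_left)
      exact (Integrable.of_bound hm.aestronglyMeasurable B (ae_of_all _ fun y => hB _)).sub
        (integrable_const _)
    change siteGenerator N α v (f + g : localAlgebra d X) x
      = siteGenerator N α v f x + siteGenerator N α v g x
    simp only [siteGenerator]
    rw [← integral_add (hi f) (hi g)]
    congr 1 with y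
    simp only [Subalgebra.coe_add, Pi.add_apply]
    ring
  map_smul' r f := by
    ext x
    change siteGenerator N α v (r • f : localAlgebra d X) x = r * siteGenerator N α v f x
    simp only [siteGenerator, ← integral_const_mul]
    congr 1 with y
    simp only [Subalgebra.coe_smul, Pi.smul_apply, smul_eq_mul]
    ring

theorem siteEnd_of_notMem [IsFiniteKernel α] (hN : ∀ w ∈ N, -w ∈ N) {S : Finset (Lattice d)}
    {v : Lattice d} (hv : v ∉ S + N) {f : localAlgebra d X}
    (hf : DependsOn f (S : Set (Lattice d))) : siteEnd N α v f = 0 :=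
  Subtype.ext (siteGenerator_of_notMem hN hv hf)

/-- A jump at `v` leaves the sites of `S` alone, so `f` is a constant factor in the integral. -/
theorem siteEnd_mul [IsFiniteKernel α] (hN : ∀ w ∈ N, -w ∈ N) {S : Finset (Lattice d)}
    {v : Lattice d} (hv : v ∉ S + N) {f : localAlgebra d X}
    (hf : DependsOn f (S : Set (Lattice d))) (g : localAlgebra d X) :
    siteEnd N α v (f * g) = f * siteEnd N α v g := by
  ext x
  change siteGenerator N α v (f * g : localAlgebra d X) x = f x * siteGenerator N α v g x
  simp only [siteGenerator, ← integral_const_mul]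
  congr 1 with y
  simp only [Subalgebra.coe_mul, Pi.mul_apply, apply_glue_of_notMem hN hv hf]
  ring

end SiteGenerator

/-! ### The generator on local functions and its product rule. -/

section Generator

variable {d : ℕ} {X : Type*} [MeasurableSpace X] {N : Finset (Lattice d)}
  {α : Kernel (N → X) (N → X)} [IsFiniteKernel α]

theorem generator_add (hN : ∀ w ∈ N, -w ∈ N) (W : Set (Lattice d)) (f g : localAlgebra d X) :
    generator N α W (f + g : localAlgebra d X) = generator N α W f + generator N α W g := by
  classical
  obtain ⟨S, hS⟩ := f.2.2.2
  obtain ⟨T, hT⟩ := g.2.2.2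
  have hS' : DependsOn (f : (Lattice d → X) → ℝ) ((S ∪ T : Finset (Lattice d)) :
    Set (Lattice d)) := fun x y h => hS fun i hi => h i (by simp_all)
  have hT' : DependsOn (g : (Lattice d → X) → ℝ) ((S ∪ T : Finset (Lattice d)) :
    Set (Lattice d)) := fun x y h => hT fun i hi => h i (by simp_all)
  have hU : DependsOn (f + g : localAlgebra d X) ((S ∪ T : Finset (Lattice d)) :
    Set (Lattice d)) := fun x y h => congrArg₂ (· + ·) (hS' h) (hT' h)
  rw [generator_eq_sum hN W subset_rfl hS', generator_eq_sum hN W subset_rfl hT',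
    generator_eq_sum hN W subset_rfl hU, ← Finset.sum_add_distrib]
  exact Finset.sum_congr rfl fun v _ => congrArg Subtype.val ((siteEnd N α v).map_add f g)

theorem generator_smul (hN : ∀ w ∈ N, -w ∈ N) (W : Set (Lattice d)) (r : ℝ)
    (f : localAlgebra d X) :
    generator N α W (r • f : localAlgebra d X) = r • generator N α W f := by
  classical
  obtain ⟨S, hS⟩ := f.2.2.2
  have hU : DependsOn (r • f : localAlgebra d X) (S : Set (Lattice d)) :=
    fun x y h => congrArg (r • ·) (hS h)
  rw [generator_eq_sum hN W subset_rfl hS, generator_eq_sum hN W subset_rfl hU, Finset.smul_sum]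
  exact Finset.sum_congr rfl fun v _ => congrArg Subtype.val ((siteEnd N α v).map_smul r f)

theorem generator_mem (hN : ∀ w ∈ N, -w ∈ N) (W : Set (Lattice d)) (f : localAlgebra d X) :
    generator N α W f ∈ localAlgebra d X := by
  classical
  obtain ⟨S, hS⟩ := f.2.2.2
  rw [generator_eq_sum hN W subset_rfl hS]
  exact Subalgebra.sum_mem _ fun v _ => (siteEnd N α v f).2

/-- The generator `G^W` as an endomorphism of the algebra of local functions. -/
noncomputable def genEnd (α : Kernel (N → X) (N → X)) [IsFiniteKernel α]
    (hN : ∀ w ∈ N, -w ∈ N) (W : Set (Lattice d)) : Module.End ℝ (localAlgebra d X) where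
  toFun f := ⟨generator N α W f, generator_mem hN W f⟩
  map_add' f g := Subtype.ext (generator_add hN W f g)
  map_smul' r f := Subtype.ext (generator_smul hN W r f)

variable (hN : ∀ w ∈ N, -w ∈ N) (W : Set (Lattice d))

theorem coe_genEnd (f : localAlgebra d X) :
    (genEnd α hN W f : (Lattice d → X) → ℝ) = generator N α W f := rfl

open Classical in
theorem genEnd_eq_sum {S V : Finset (Lattice d)} (hV : S + N ⊆ V) {f : localAlgebra d X}
    (hf : DependsOn f (S : Set (Lattice d))) :
    genEnd α hN W f = ∑ v ∈ V with v ∈ W, siteEnd N α v f := by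
  apply Subtype.ext
  rw [coe_genEnd, generator_eq_sum hN W hV hf, AddSubmonoidClass.coe_finsetSum]
  rfl

/-- One step from `N` leads to the sites whose jumps can reach `S`, a second one to the windows that
determine their rates. -/
theorem dependsOn_genEnd (hN0 : 0 ∈ N) {S : Finset (Lattice d)} {f : localAlgebra d X}
    (hf : DependsOn f (S : Set (Lattice d))) :
    DependsOn (genEnd α hN W f) (thicken N 2 S : Set (Lattice d)) := by
  classical
  intro x y h
  rw [genEnd_eq_sum hN W subset_rfl hf, localAlgebra.sum_apply, localAlgebra.sum_apply]
  refine Finset.sum_congr rfl fun v hv => dependsOn_siteGenerator v hf fun w hw => h w ?_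
  have hv' : v ∈ S + N := (Finset.mem_filter.1 hv).1
  rcases Finset.mem_union.1 hw with hw | hw
  · exact subset_thicken hN0 2 S hw
  · obtain ⟨z, hz, rfl⟩ := Finset.mem_image.1 hw
    exact Finset.mem_add.2 ⟨v, hv', z, hz, add_comm _ _⟩

theorem genEnd_congr {S : Finset (Lattice d)} {f : localAlgebra d X}
    (hf : DependsOn f (S : Set (Lattice d))) {W' : Set (Lattice d)}
    (h : ∀ v ∈ S + N, v ∈ W ↔ v ∈ W') : genEnd α hN W f = genEnd α hN W' f := by
  classical
  rw [genEnd_eq_sum hN W subset_rfl hf, genEnd_eq_sum hN W' subset_rfl hf]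
  exact Finset.sum_congr (Finset.filter_congr h) fun _ _ => rfl

/-- No jump reaches both supports: at each site one factor is inert, and its term in the product
rule vanishes. -/
theorem genEnd_mul {S T : Finset (Lattice d)} {f g : localAlgebra d X}
    (hf : DependsOn f (S : Set (Lattice d))) (hg : DependsOn g (T : Set (Lattice d)))
    (h : Disjoint (S + N) (T + N)) :
    genEnd α hN W (f * g) = genEnd α hN W f * g + f * genEnd α hN W g := by
  classical
  have hfg : DependsOn (f * g : localAlgebra d X) ((S ∪ T : Finset (Lattice d)) :
      Set (Lattice d)) := by
    intro x y h
    rw [Subalgebra.coe_mul, Pi.mul_apply, Pi.mul_apply, hf fun i hi => h i (by simp_all),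
      hg fun i hi => h i (by simp_all)]
  set V := (S ∪ T) + N
  have hS : S + N ⊆ V := Finset.add_subset_add_right Finset.subset_union_left
  have hT : T + N ⊆ V := Finset.add_subset_add_right Finset.subset_union_right
  rw [genEnd_eq_sum hN W (subset_refl V) hfg, genEnd_eq_sum hN W hS hf, genEnd_eq_sum hN W hT hg,
    Finset.sum_mul, Finset.mul_sum, ← Finset.sum_add_distrib]
  refine Finset.sum_congr rfl fun v _ => ?_
  by_cases hv : v ∈ S + N
  · have hv' : v ∉ T + N := Finset.disjoint_left.1 h hv
    rw [mul_comm f g, siteEnd_mul hN hv' hg, siteEnd_of_notMem hN hv' hg, mul_zero, add_zero,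
      mul_comm]
  · rw [siteEnd_mul hN hv hf, siteEnd_of_notMem hN hv hf, zero_mul, zero_add]

end Generator

/-! ### Powers of the generator and partial sums of the exponential series. -/

section Powers

variable {d : ℕ} {X : Type*} [MeasurableSpace X] {N : Finset (Lattice d)}
  {α : Kernel (N → X) (N → X)} [IsFiniteKernel α]
  (hN : ∀ w ∈ N, -w ∈ N) (W : Set (Lattice d))

theorem dependsOn_genEnd_pow (hN0 : 0 ∈ N) {S : Finset (Lattice d)} {f : localAlgebra d X}
    (hf : DependsOn f (S : Set (Lattice d))) (n : ℕ) :
    DependsOn ((genEnd α hN W ^ n) f) (thicken N (2 * n) S : Set (Lattice d)) := by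
  induction n with
  | zero => simpa using hf
  | succ n ih =>
    have h := dependsOn_genEnd (α := α) hN W hN0 ih
    rwa [← thicken_add, ← Module.End.mul_apply, ← pow_succ', add_comm 2, ← Nat.mul_succ] at h

/-- The innermost generator is expanded into at most `s |N|` site terms, each of which turns `B`
into `2cB` and `s` into `s + |N|`. Treating the terms separately makes the supports grow linearly in
`n`; the bound from `thicken` would be exponential. -/
theorem abs_genEnd_pow_le {c : ℝ≥0} (hα : ∀ x, α x Set.univ ≤ c) (n : ℕ) {s : ℕ}
    {S : Finset (Lattice d)} (hs : S.card ≤ s) {f : localAlgebra d X}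
    (hf : DependsOn f (S : Set (Lattice d))) {B : ℝ} (hB : ∀ x, |f x| ≤ B)
    (x : Lattice d → X) :
    |(genEnd α hN W ^ n) f x| ≤
      B * ∏ k ∈ Finset.range n, (2 * c * N.card * (s + k * N.card) : ℝ) := by
  classical
  induction n generalizing s S f B with
  | zero => simpa using hB x
  | succ n ih =>
    have hB0 : 0 ≤ B := (abs_nonneg _).trans (hB x)
    rw [pow_succ, Module.End.mul_apply, genEnd_eq_sum hN W subset_rfl hf, map_sum,
      localAlgebra.sum_apply]
    set b := (2 * c * B) *
      ∏ k ∈ Finset.range n, (2 * c * N.card * ((s + N.card : ℕ) + k * N.card) : ℝ) with hb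
    have hb0 : 0 ≤ b := by positivity
    have hterm : ∀ v ∈ (S + N).filter (· ∈ W),
        |(genEnd α hN W ^ n) (siteEnd N α v f) x| ≤ b := fun v _ =>
      ih (S := S ∪ N.image (· + v))
        ((Finset.card_union_le _ _).trans (add_le_add hs Finset.card_image_le))
        (dependsOn_siteGenerator v hf) (abs_siteGenerator_le hα v hB)
    have hcard : (((S + N).filter (· ∈ W)).card : ℝ) ≤ s * N.card := by
      exact_mod_cast (Finset.card_filter_le _ _).trans
        (Finset.card_add_le.trans (Nat.mul_le_mul_right _ hs))
    calc _ ≤ ∑ v ∈ (S + N).filter (· ∈ W), |(genEnd α hN W ^ n) (siteEnd N α v f) x| :=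
          Finset.abs_sum_le_sum_abs _ _
      _ ≤ ((S + N).filter (· ∈ W)).card • b := Finset.sum_le_card_nsmul _ _ _ hterm
      _ ≤ (s * N.card) * b := by rw [nsmul_eq_mul]; gcongr
      _ = _ := by
        rw [Finset.prod_range_succ', hb]
        have : ∀ k : ℕ, (2 * c * N.card * (((s + N.card : ℕ) : ℝ) + k * N.card) : ℝ)
            = 2 * c * N.card * (s + (k + 1 : ℕ) * N.card) := by
          intro k; push_cast; ring
        simp only [this]
        push_cast
        ring

theorem genEnd_pow_mul (hN0 : 0 ∈ N) {S T : Finset (Lattice d)} {f g : localAlgebra d X}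
    (hf : DependsOn f (S : Set (Lattice d))) (hg : DependsOn g (T : Set (Lattice d))) (n : ℕ)
    (h : Disjoint (thicken N (2 * n) S) (thicken N (2 * n) T)) :
    (genEnd α hN W ^ n) (f * g) = ∑ p ∈ Finset.HasAntidiagonal.antidiagonal n,
      n.choose p.1 • ((genEnd α hN W ^ p.1) f * (genEnd α hN W ^ p.2) g) := by
  induction n with
  | zero => simp
  | succ n ih =>
    have hle (k : ℕ) (hk : k ≤ 2 * (n + 1)) (U : Finset (Lattice d)) :
      thicken N k U ⊆ thicken N (2 * (n + 1)) U := thicken_mono_left hN0 hk U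
    rw [Finset.sum_antidiagonal_choose_succ_nsmul
        (fun i j => (genEnd α hN W ^ i) f * (genEnd α hN W ^ j) g), pow_succ',
      Module.End.mul_apply,
      ih (h.mono (hle _ (by omega) _) (hle _ (by omega) _)), map_sum,
      ← Finset.sum_add_distrib]
    refine Finset.sum_congr rfl fun p hp => ?_
    have hp' : p.1 + p.2 = n := Finset.HasAntidiagonal.mem_antidiagonal.1 hp
    have hd : Disjoint (thicken N (2 * p.1) S + N) (thicken N (2 * p.2) T + N) := by
      rw [← thicken_succ', ← thicken_succ']
      exact h.mono (hle _ (by omega) _) (hle _ (by omega) _)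
    rw [map_nsmul, genEnd_mul hN W (dependsOn_genEnd_pow hN W hN0 hf p.1)
      (dependsOn_genEnd_pow hN W hN0 hg p.2) hd, ← Module.End.mul_apply, ← pow_succ',
      ← Module.End.mul_apply, ← pow_succ', smul_add, add_comm,
      Nat.choose_symm_of_eq_add hp'.symm]

/-- The `n`-th term of the exponential series of `t G^W`. -/
noncomputable def expTerm (α : Kernel (N → X) (N → X)) [IsFiniteKernel α]
    (hN : ∀ w ∈ N, -w ∈ N) (W : Set (Lattice d)) (t : ℝ) (n : ℕ) :
    Module.End ℝ (localAlgebra d X) :=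
  (t ^ n / n.factorial) • genEnd α hN W ^ n

/-- The partial sum of the first `n` terms of the exponential series of `t G^W`. -/
noncomputable def expSum (α : Kernel (N → X) (N → X)) [IsFiniteKernel α]
    (hN : ∀ w ∈ N, -w ∈ N) (W : Set (Lattice d)) (t : ℝ) (n : ℕ) :
    Module.End ℝ (localAlgebra d X) :=
  ∑ i ∈ Finset.range n, expTerm α hN W t i

theorem expTerm_apply (t : ℝ) (n : ℕ) (f : localAlgebra d X) (x : Lattice d → X) :
    expTerm α hN W t n f x = t ^ n / n.factorial * (genEnd α hN W ^ n) f x := rfl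

theorem expSum_apply (t : ℝ) (n : ℕ) (f : localAlgebra d X) (x : Lattice d → X) :
    expSum α hN W t n f x = ∑ i ∈ Finset.range n, expTerm α hN W t i f x := by
  rw [expSum, LinearMap.sum_apply, localAlgebra.sum_apply]

theorem dependsOn_expSum (hN0 : 0 ∈ N) (t : ℝ) {S : Finset (Lattice d)} {f : localAlgebra d X}
    (hf : DependsOn f (S : Set (Lattice d))) (n : ℕ) :
    DependsOn (expSum α hN W t n f) (thicken N (2 * n) S : Set (Lattice d)) := by
  intro x y h
  simp only [expSum_apply, expTerm_apply]
  refine Finset.sum_congr rfl fun i hi => ?_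
  rw [dependsOn_genEnd_pow hN W hN0 hf i fun w hw => h w
    (thicken_mono_left hN0 (by have := Finset.mem_range.1 hi; omega) S hw)]

theorem expTerm_mul (hN0 : 0 ∈ N) (t : ℝ) {S T : Finset (Lattice d)} {f g : localAlgebra d X}
    (hf : DependsOn f (S : Set (Lattice d))) (hg : DependsOn g (T : Set (Lattice d))) (n : ℕ)
    (h : Disjoint (thicken N (2 * n) S) (thicken N (2 * n) T)) (x : Lattice d → X) :
    expTerm α hN W t n (f * g) x = ∑ p ∈ Finset.HasAntidiagonal.antidiagonal n,
      expTerm α hN W t p.1 f x * expTerm α hN W t p.2 g x := by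
  rw [expTerm_apply, genEnd_pow_mul hN W hN0 hf hg n h, localAlgebra.sum_apply, Finset.mul_sum]
  refine Finset.sum_congr rfl fun p hp => ?_
  obtain ⟨i, j⟩ := p
  obtain rfl : i + j = n := Finset.HasAntidiagonal.mem_antidiagonal.1 hp
  simp only [expTerm_apply]
  change _ * ((i + j).choose i • ((genEnd α hN W ^ i) f x * (genEnd α hN W ^ j) g x)) = _
  have hc : ((i + j).choose i : ℝ) * (i.factorial * j.factorial) = (i + j).factorial := by
    exact_mod_cast (by
      rw [← mul_assoc, Nat.choose_symm_add]
      exact Nat.add_choose_mul_factorial_mul_factorial i j)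
  have h0 : ((i + j).factorial : ℝ) ≠ 0 := by positivity
  rw [nsmul_eq_mul, pow_add]
  field_simp
  rw [← hc]
  ring

/-- As `m ≥ 1`, each factor is at most `m (s + 1 + k)`, and `(s+1)⋯(s+n) = n! (s+n choose n)`. The
`n!` is what the exponential series cancels. -/
theorem prod_add_mul_le {m : ℝ} (hm : 1 ≤ m) (s n : ℕ) :
    ∏ k ∈ Finset.range n, (s + k * m : ℝ) ≤ m ^ n * (n.factorial * 2 ^ (s + n)) := by
  have h1 : ∏ k ∈ Finset.range n, (s + k * m : ℝ) ≤ m ^ n * (s + 1).ascFactorial n := by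
    induction n with
    | zero => simp
    | succ n ih =>
      rw [Finset.prod_range_succ, Nat.ascFactorial_succ, pow_succ]
      push_cast
      calc _ ≤ (m ^ n * (s + 1).ascFactorial n) * (m * (s + 1 + n)) := by
            gcongr
            nlinarith [(Nat.cast_nonneg s : (0 : ℝ) ≤ s)]
        _ = _ := by ring
  refine h1.trans (mul_le_mul_of_nonneg_left ?_ (by positivity))
  rw [Nat.ascFactorial_eq_factorial_mul_choose]
  push_cast
  gcongr
  exact_mod_cast Nat.choose_le_two_pow _ _

/-- In the constant `8`, one factor `2` comes from `abs_siteGenerator_le`, one from the power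
`2^(s+n)` of `prod_add_mul_le`, and the third leaves the ratio `1/2`. -/
theorem mul_abs_genEnd_pow_le (hN0 : 0 ∈ N) {c : ℝ≥0} (hα : ∀ x, α x Set.univ ≤ c) {t : ℝ}
    (ht0 : 0 ≤ t) (ht : t * (8 * c * N.card ^ 2) ≤ 1) (n : ℕ) {s : ℕ}
    {S : Finset (Lattice d)} (hs : S.card ≤ s) {f : localAlgebra d X}
    (hf : DependsOn f (S : Set (Lattice d))) {B : ℝ} (hB : ∀ x, |f x| ≤ B)
    (x : Lattice d → X) :
    t ^ n / n.factorial * |(genEnd α hN W ^ n) f x| ≤ B * 2 ^ s * (1 / 2) ^ n := by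
  have hB0 : 0 ≤ B := (abs_nonneg _).trans (hB x)
  have hm : (1 : ℝ) ≤ N.card := by exact_mod_cast Finset.card_pos.2 ⟨0, hN0⟩
  have h0 : (n.factorial : ℝ) ≠ 0 := by positivity
  calc _ ≤ t ^ n / n.factorial * (B * ((2 * c * N.card) ^ n *
        (N.card ^ n * (n.factorial * 2 ^ (s + n))))) := by
        gcongr
        refine (abs_genEnd_pow_le hN W hα n hs hf hB x).trans ?_
        rw [Finset.prod_mul_distrib, Finset.prod_const, Finset.card_range]
        gcongr
        exact prod_add_mul_le hm s n
    _ = B * 2 ^ s * (t * (8 * c * N.card ^ 2) * (1 / 2)) ^ n := by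
        have : t * (8 * c * N.card ^ 2) * (1 / 2) = t * (2 * c * N.card) * N.card * 2 := by ring
        rw [this, mul_pow, mul_pow, mul_pow, pow_add]
        rw [div_mul_eq_mul_div, div_eq_iff h0]
        ring
    _ ≤ _ := by
        gcongr
        linarith

theorem abs_expTerm_apply_le (hN0 : 0 ∈ N) {c : ℝ≥0} (hα : ∀ x, α x Set.univ ≤ c) {t : ℝ}
    (ht0 : 0 ≤ t) (ht : t * (8 * c * N.card ^ 2) ≤ 1) (n : ℕ) {s : ℕ}
    {S : Finset (Lattice d)} (hs : S.card ≤ s) {f : localAlgebra d X}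
    (hf : DependsOn f (S : Set (Lattice d))) {B : ℝ} (hB : ∀ x, |f x| ≤ B)
    (x : Lattice d → X) :
    |expTerm α hN W t n f x| ≤ B * 2 ^ s * (1 / 2) ^ n := by
  rw [expTerm_apply, abs_mul, abs_of_nonneg (by positivity)]
  exact mul_abs_genEnd_pow_le hN W hN0 hα ht0 ht n hs hf hB x

theorem abs_expSum_apply_le (hN0 : 0 ∈ N) {c : ℝ≥0} (hα : ∀ x, α x Set.univ ≤ c) {t : ℝ}
    (ht0 : 0 ≤ t) (ht : t * (8 * c * N.card ^ 2) ≤ 1) (n : ℕ) {s : ℕ}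
    {S : Finset (Lattice d)} (hs : S.card ≤ s) {f : localAlgebra d X}
    (hf : DependsOn f (S : Set (Lattice d))) {B : ℝ} (hB : ∀ x, |f x| ≤ B)
    (x : Lattice d → X) :
    |expSum α hN W t n f x| ≤ n * (B * 2 ^ s) := by
  have hB0 : 0 ≤ B := (abs_nonneg _).trans (hB x)
  rw [expSum_apply]
  refine (Finset.abs_sum_le_sum_abs _ _).trans ?_
  refine (Finset.sum_le_card_nsmul _ _ (B * 2 ^ s) fun i _ => ?_).trans (by simp)
  refine (abs_expTerm_apply_le hN W hN0 hα ht0 ht i hs hf hB x).trans ?_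
  exact mul_le_of_le_one_right (by positivity) (pow_le_one₀ (by norm_num) (by norm_num))

/-- The difference consists of the pairs in the square of side `n` with `i + j ≥ n`: at most `n²` of
them, each contributing at most `C D 2^(-n)`. -/
theorem sum_antidiagonal_sub_mul_sum_le {a b : ℕ → ℝ} {C D : ℝ} (hC : 0 ≤ C) (hD : 0 ≤ D)
    (ha : ∀ i, |a i| ≤ C * (1 / 2) ^ i) (hb : ∀ i, |b i| ≤ D * (1 / 2) ^ i) (n : ℕ) :
    |∑ k ∈ Finset.range n, ∑ p ∈ Finset.HasAntidiagonal.antidiagonal k, a p.1 * b p.2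
      - (∑ i ∈ Finset.range n, a i) * ∑ j ∈ Finset.range n, b j|
      ≤ n ^ 2 * (C * D * (1 / 2) ^ n) := by
  set Q := Finset.range n ×ˢ Finset.range n
  have h1 : ∑ k ∈ Finset.range n, ∑ p ∈ Finset.HasAntidiagonal.antidiagonal k, a p.1 * b p.2
      = ∑ p ∈ Q with p.1 + p.2 < n, a p.1 * b p.2 := by
    rw [← Finset.sum_fiberwise_of_maps_to (s := Q.filter fun p => p.1 + p.2 < n)
      (t := Finset.range n) (g := fun p => p.1 + p.2) (by simp)]
    refine Finset.sum_congr rfl fun k hk => Finset.sum_congr ?_ fun _ _ => rfl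
    ext ⟨i, j⟩
    simp only [Q, Finset.HasAntidiagonal.mem_antidiagonal, Finset.mem_filter, Finset.mem_product,
      Finset.mem_range] at hk ⊢
    omega
  have h2 : (∑ i ∈ Finset.range n, a i) * ∑ j ∈ Finset.range n, b j
      = ∑ p ∈ Q, a p.1 * b p.2 := by
    rw [Finset.sum_mul_sum, Finset.sum_product]
  rw [h1, h2, ← Finset.sum_filter_add_sum_filter_not Q (fun p => p.1 + p.2 < n),
    sub_add_cancel_left, abs_neg]
  refine (Finset.abs_sum_le_sum_abs _ _).trans ?_
  refine (Finset.sum_le_card_nsmul _ _ (C * D * (1 / 2) ^ n) fun p hp => ?_).trans ?_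
  · have hp' : n ≤ p.1 + p.2 := not_lt.1 (Finset.mem_filter.1 hp).2
    rw [abs_mul]
    calc _ ≤ (C * (1 / 2) ^ p.1) * (D * (1 / 2) ^ p.2) :=
          mul_le_mul (ha _) (hb _) (abs_nonneg _) (by positivity)
      _ = C * D * (1 / 2) ^ (p.1 + p.2) := by rw [pow_add]; ring
      _ ≤ _ := by
        gcongr ?_ * ?_
        exact pow_le_pow_of_le_one (by norm_num) (by norm_num) hp'
  · rw [nsmul_eq_mul]
    gcongr
    refine (Nat.cast_le.2 (Finset.card_filter_le _ _)).trans ?_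
    simp [Q, sq]

theorem abs_expSum_mul_sub_le (hN0 : 0 ∈ N) {c : ℝ≥0} (hα : ∀ x, α x Set.univ ≤ c) {t : ℝ}
    (ht0 : 0 ≤ t) (ht : t * (8 * c * N.card ^ 2) ≤ 1) (n : ℕ) {s : ℕ}
    {S T : Finset (Lattice d)} (hs : S.card ≤ s) (hs' : T.card ≤ s) {f g : localAlgebra d X}
    (hf : DependsOn f (S : Set (Lattice d))) (hg : DependsOn g (T : Set (Lattice d)))
    {B : ℝ} (hB : ∀ x, |f x| ≤ B) (hB' : ∀ x, |g x| ≤ B)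
    (h : Disjoint (thicken N (2 * n) S) (thicken N (2 * n) T)) (x : Lattice d → X) :
    |expSum α hN W t n (f * g) x - expSum α hN W t n f x * expSum α hN W t n g x|
      ≤ n ^ 2 * ((B * 2 ^ s) * (B * 2 ^ s) * (1 / 2) ^ n) := by
  have hB0 : 0 ≤ B := (abs_nonneg _).trans (hB x)
  simp only [expSum_apply]
  have h1 : ∀ k ∈ Finset.range n, expTerm α hN W t k (f * g) x = _ := fun k hk => by
    have hk := Finset.mem_range.1 hk
    exact expTerm_mul hN W hN0 t hf hg k (h.mono (thicken_mono_left hN0 (by omega) _)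
      (thicken_mono_left hN0 (by omega) _)) x
  rw [Finset.sum_congr rfl h1]
  exact sum_antidiagonal_sub_mul_sum_le (by positivity) (by positivity)
    (fun i => abs_expTerm_apply_le hN W hN0 hα ht0 ht i hs hf hB x)
    (fun i => abs_expTerm_apply_le hN W hN0 hα ht0 ht i hs' hg hB' x) n

end Powers

/-! ### Contraction and right derivative of the semigroup. -/

section Semigroup

variable {E : Type*} [MeasurableSpace E] {μ : ℝ≥0 → Kernel E E}

theorem IsMarkovianFamily.semigroup_zero (hμ : IsMarkovianFamily μ) {f : E → ℝ}
    (hf : Measurable f) : semigroup μ 0 f = f := by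
  ext x
  rw [semigroup, hμ.zero, Kernel.id_apply, integral_dirac' _ _ hf.stronglyMeasurable]

theorem measurable_semigroup (hμ : IsMarkovianFamily μ) (t : ℝ≥0) {f : E → ℝ}
    (hf : Measurable f) : Measurable (semigroup μ t f) := by
  have := hμ.markov t
  exact hf.stronglyMeasurable.integral_kernel.measurable

theorem IsMarkovianFamily.integrable (hμ : IsMarkovianFamily μ) (t : ℝ≥0) (x : E) {f : E → ℝ}
    (hf : Measurable f) {B : ℝ} (hB : ∀ x, |f x| ≤ B) : Integrable f (μ t x) := by
  have := hμ.markov t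
  exact .of_bound hf.aestronglyMeasurable B (ae_of_all _ hB)

theorem abs_semigroup_le (hμ : IsMarkovianFamily μ) (t : ℝ≥0) {f : E → ℝ} {B : ℝ}
    (hB : ∀ x, |f x| ≤ B) (x : E) : |semigroup μ t f x| ≤ B := by
  have := hμ.markov t
  have h : ∀ y, ‖f y‖ ≤ B := hB
  simpa [semigroup] using norm_integral_le_of_norm_le_const (μ := μ t x) (ae_of_all _ h)

theorem semigroup_sub (hμ : IsMarkovianFamily μ) (t : ℝ≥0) {f g : E → ℝ}
    (hf : Measurable f) {B : ℝ} (hB : ∀ x, |f x| ≤ B)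
    (hg : Measurable g) {C : ℝ} (hC : ∀ x, |g x| ≤ C) (x : E) :
    semigroup μ t (fun y => f y - g y) x = semigroup μ t f x - semigroup μ t g x :=
  integral_sub (hμ.integrable t x hf hB) (hμ.integrable t x hg hC)

theorem semigroup_const_mul (t : ℝ≥0) (r : ℝ) (f : E → ℝ) (x : E) :
    semigroup μ t (fun y => r * f y) x = r * semigroup μ t f x :=
  integral_const_mul _ _

theorem semigroup_add (hμ : IsMarkovianFamily μ) (s t : ℝ≥0) {f : E → ℝ}
    (hf : Measurable f) {B : ℝ} (hB : ∀ x, |f x| ≤ B) (x : E) :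
    semigroup μ (s + t) f x = semigroup μ s (semigroup μ t f) x := by
  have := hμ.markov s
  have := hμ.markov t
  have hi : Integrable f ((μ t ∘ₖ μ s) x) := by
    rw [← hμ.add]
    exact hμ.integrable (s + t) x hf hB
  rw [semigroup, hμ.add, Kernel.integral_comp hi]
  rfl

variable {C : Set (E → ℝ)} {G : (E → ℝ) → E → ℝ}

theorem HasGeneratorOn.eventually (hgen : HasGeneratorOn μ C G) {f : E → ℝ} (hf : f ∈ C)
    {ε : ℝ} (hε : 0 < ε) : ∃ δ : ℝ≥0, 0 < δ ∧ ∀ h : ℝ≥0, 0 < h → h < δ → ∀ x,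
      |(h : ℝ)⁻¹ * (semigroup μ h f x - f x) - G f x| ≤ ε := by
  have h1 := Metric.tendstoUniformly_iff.1 (hgen f hf) ε hε
  obtain ⟨δ, hδ, h2⟩ := mem_nhdsGT_iff_exists_Ioo_subset.1 h1
  refine ⟨δ, hδ, fun h h0 hh x => ?_⟩
  have := h2 ⟨h0, hh⟩ x
  rw [dist_comm, Real.dist_eq] at this
  exact this.le

/-- The expression is `P_t` applied to `P_h f - f - h G f`, and `P_t` is a contraction; hence `δ`
works for all `t`. -/
theorem abs_semigroup_increment_le (hμ : IsMarkovianFamily μ) (hgen : HasGeneratorOn μ C G)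
    {f : E → ℝ} (hf : f ∈ C) (hfm : Measurable f) {B : ℝ} (hB : ∀ x, |f x| ≤ B)
    (hGm : Measurable (G f)) {B' : ℝ} (hB' : ∀ x, |G f x| ≤ B') {ε : ℝ} (hε : 0 < ε) :
    ∃ δ : ℝ≥0, 0 < δ ∧ ∀ t h : ℝ≥0, h < δ → ∀ x,
      |semigroup μ (t + h) f x - semigroup μ t f x - h * semigroup μ t (G f) x| ≤ ε * h := by
  obtain ⟨δ, hδ, H⟩ := hgen.eventually hf hε
  refine ⟨δ, hδ, fun t h hh x => ?_⟩
  rcases eq_or_ne h 0 with rfl | h0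
  · simp
  have hpos : (0 : ℝ) < h := by exact_mod_cast pos_iff_ne_zero.2 h0
  have hP := measurable_semigroup hμ h hfm
  have hPm : Measurable fun y => semigroup μ h f y - f y := hP.sub hfm
  have hPB : ∀ y, |semigroup μ h f y - f y| ≤ B + B := fun y =>
    (abs_sub _ _).trans (add_le_add (abs_semigroup_le hμ h hB y) (hB y))
  have hGB : ∀ y, |h * G f y| ≤ h * B' := fun y => by
    rw [abs_mul, abs_of_pos hpos]
    exact mul_le_mul_of_nonneg_left (hB' y) hpos.le
  rw [semigroup_add hμ t h hfm hB, ← semigroup_sub hμ t hP (abs_semigroup_le hμ h hB) hfm hB,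
    ← semigroup_const_mul, ← semigroup_sub hμ t hPm hPB (hGm.const_mul _) hGB]
  refine abs_semigroup_le hμ t (fun y => ?_) x
  have := H h (pos_iff_ne_zero.2 h0) hh y
  have e : semigroup μ h f y - f y - h * G f y
      = h * ((h : ℝ)⁻¹ * (semigroup μ h f y - f y) - G f y) := by
    field_simp
  rw [e, abs_mul, abs_of_pos hpos, mul_comm]
  exact mul_le_mul_of_nonneg_right this hpos.le

/-- The generator gives right derivatives only; with two-sided continuity they suffice for the
comparison of growth in Taylor's formula. -/
theorem continuous_semigroup (hμ : IsMarkovianFamily μ) (hgen : HasGeneratorOn μ C G)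
    {f : E → ℝ} (hf : f ∈ C) (hfm : Measurable f) {B : ℝ} (hB : ∀ x, |f x| ≤ B)
    (hGm : Measurable (G f)) {B' : ℝ} (hB' : ∀ x, |G f x| ≤ B') (x : E) :
    Continuous fun t : ℝ≥0 => semigroup μ t f x := by
  obtain ⟨δ, hδ, H⟩ := abs_semigroup_increment_le hμ hgen hf hfm hB hGm hB' one_pos
  have hB0 : 0 ≤ B' := (abs_nonneg _).trans (hB' x)
  have key : ∀ s t : ℝ≥0, s ≤ t → dist s t < δ →
      dist (semigroup μ s f x) (semigroup μ t f x) ≤ (B' + 1) * dist s t := by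
    intro s t hst hd
    obtain ⟨h, rfl⟩ := exists_add_of_le hst
    have hd' : dist s (s + h) = h := by
      rw [NNReal.dist_eq, abs_sub_comm]; simp
    rw [hd'] at hd ⊢
    rw [dist_comm, Real.dist_eq]
    have h1 := H s h (by exact_mod_cast hd) x
    have h2 : |h * semigroup μ s (G f) x| ≤ h * B' := by
      rw [abs_mul, NNReal.abs_eq]
      exact mul_le_mul_of_nonneg_left (abs_semigroup_le hμ s hB' x) h.2
    calc _ = |(semigroup μ (s + h) f x - semigroup μ s f x - h * semigroup μ s (G f) x)
          + h * semigroup μ s (G f) x| := by ring_nf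
      _ ≤ 1 * h + h * B' := (abs_add_le _ _).trans (add_le_add h1 h2)
      _ = _ := by ring
  rw [Metric.continuous_iff]
  intro t ε hε
  refine ⟨min δ (ε / (B' + 1)), by positivity, fun s hs => ?_⟩
  obtain ⟨hs1, hs2⟩ := lt_min_iff.1 hs
  have : dist (semigroup μ s f x) (semigroup μ t f x) ≤ (B' + 1) * dist s t := by
    rcases le_total s t with h | h
    · exact key s t h hs1
    · rw [dist_comm, dist_comm s]
      exact key t s h (by rwa [dist_comm])
  refine this.trans_lt ?_
  rwa [lt_div_iff₀' (by positivity)] at hs2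

theorem hasDerivWithinAt_semigroup (hμ : IsMarkovianFamily μ) (hgen : HasGeneratorOn μ C G)
    {f : E → ℝ} (hf : f ∈ C) (hfm : Measurable f) {B : ℝ} (hB : ∀ x, |f x| ≤ B)
    (hGm : Measurable (G f)) {B' : ℝ} (hB' : ∀ x, |G f x| ≤ B') (x : E) {t : ℝ} (ht : 0 ≤ t) :
    HasDerivWithinAt (fun t : ℝ => semigroup μ t.toNNReal f x)
      (semigroup μ t.toNNReal (G f) x) (Set.Ici t) t := by
  rw [hasDerivWithinAt_iff_isLittleO, Asymptotics.isLittleO_iff]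
  intro ε hε
  obtain ⟨δ, hδ, H⟩ := abs_semigroup_increment_le hμ hgen hf hfm hB hGm hB' hε
  have hmem : Set.Ico t (t + δ) ∈ 𝓝[≥] t := Ico_mem_nhdsGE (by simpa using hδ)
  filter_upwards [hmem] with s hs
  have h0 : 0 ≤ s - t := by linarith [hs.1]
  have e : s.toNNReal = t.toNNReal + (s - t).toNNReal := by
    rw [← Real.toNNReal_add ht h0]; ring_nf
  have hlt : (s - t).toNNReal < δ := by
    rw [Real.toNNReal_lt_iff_lt_coe h0]; linarith [hs.2]
  have := H t.toNNReal _ hlt x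
  rw [← e, Real.coe_toNNReal _ h0] at this
  rwa [Real.norm_eq_abs, Real.norm_eq_abs, abs_of_nonneg h0, smul_eq_mul]

end Semigroup

/-! ### Taylor's formula for the semigroup. -/

section Taylor

variable {d : ℕ} {X : Type*} [MeasurableSpace X] {N : Finset (Lattice d)}
  {α : Kernel (N → X) (N → X)} [IsFiniteKernel α]
  (hN : ∀ w ∈ N, -w ∈ N) {W : Set (Lattice d)}
  {μ : ℝ≥0 → Kernel (Lattice d → X) (Lattice d → X)}

theorem hasDerivAt_pow_succ_div_factorial (n : ℕ) (t : ℝ) :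
    HasDerivAt (fun t : ℝ => t ^ (n + 1) / (n + 1).factorial) (t ^ n / n.factorial) t := by
  have h := (hasDerivAt_pow (n + 1) t).div_const ((n + 1).factorial : ℝ)
  refine h.congr_deriv ?_
  rw [Nat.factorial_succ]
  push_cast
  field_simp

/-- The right derivative in `t` of the remainder of order `n + 1` for `f` is the remainder of order
`n` for `G f`, so the bounds integrate. Order zero is contractivity. -/
theorem abs_semigroup_sub_expSum_le (hμ : IsMarkovianFamily μ)
    (hgen : HasGeneratorOn μ (localFunctions d X) (generator N α W)) (n : ℕ)
    (f : localAlgebra d X) {C : ℝ} (hC : ∀ x, |(genEnd α hN W ^ n) f x| ≤ C) (t : ℝ≥0)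
    (x : Lattice d → X) :
    |semigroup μ t f x - expSum α hN W t n f x| ≤ t ^ n / n.factorial * C := by
  induction n generalizing f t with
  | zero =>
    simpa [expSum_apply] using abs_semigroup_le hμ t (f := f) (by simpa using hC) x
  | succ n ih =>
    set g := genEnd α hN W f
    have hC' : ∀ x, |(genEnd α hN W ^ n) g x| ≤ C := by
      simpa only [pow_succ, Module.End.mul_apply] using hC
    obtain ⟨B, hB⟩ := localAlgebra.exists_bound f
    obtain ⟨B', hB'⟩ := localAlgebra.exists_bound g
    have hsum : ∀ t : ℝ, HasDerivAt (fun t : ℝ => expSum α hN W t (n + 1) f x)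
        (expSum α hN W t n g x) t := by
      intro t
      simp only [expSum_apply, Finset.sum_range_succ' _ n, expTerm_apply]
      have h : HasDerivAt (fun t : ℝ => ∑ i ∈ Finset.range n,
          t ^ (i + 1) / (i + 1).factorial * (genEnd α hN W ^ (i + 1)) f x)
          (∑ i ∈ Finset.range n, t ^ i / i.factorial * (genEnd α hN W ^ i) g x) t := by
        refine HasDerivAt.fun_sum fun i _ => ?_
        rw [pow_succ (genEnd α hN W), Module.End.mul_apply]
        exact (hasDerivAt_pow_succ_div_factorial i t).mul_const _
      simpa only [pow_zero, Nat.factorial_zero, Nat.cast_one, div_one, one_mul,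
        Module.End.one_apply] using h.add_const (f x)
    have hcont : Continuous fun t : ℝ => semigroup μ t.toNNReal f x :=
      (continuous_semigroup hμ hgen f.2 (localAlgebra.measurable f) hB
        (localAlgebra.measurable g) hB' x).comp continuous_real_toNNReal
    have key := image_norm_le_of_norm_deriv_right_le_deriv_boundary
      (f := fun t : ℝ => semigroup μ t.toNNReal f x - expSum α hN W t (n + 1) f x)
      (f' := fun t : ℝ => semigroup μ t.toNNReal g x - expSum α hN W t n g x)
      (B := fun t => t ^ (n + 1) / (n + 1).factorial * C)
      (B' := fun t => t ^ n / n.factorial * C) (a := 0) (b := t)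
      (hcont.sub (continuous_iff_continuousAt.2 fun t => (hsum t).continuousAt)).continuousOn
      (fun s hs => (hasDerivWithinAt_semigroup hμ hgen f.2 (localAlgebra.measurable f) hB
        (localAlgebra.measurable g) hB' x hs.1).sub (hsum s).hasDerivWithinAt)
      (by
        simp [expSum_apply, expTerm_apply, Finset.sum_range_succ' _ n,
          hμ.semigroup_zero (localAlgebra.measurable f)])
      (fun s => (hasDerivAt_pow_succ_div_factorial n s).mul_const C)
      (fun s hs => by
        have := ih g hC' s.toNNReal
        rwa [Real.coe_toNNReal _ hs.1] at this)
      (x := t) ⟨t.2, le_rfl⟩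
    simpa using key

end Taylor

/-! ### Finite-range approximations over several time steps. -/

section StepProd

variable {d : ℕ} {X : Type*} [MeasurableSpace X] {N : Finset (Lattice d)}
  {α : Kernel (N → X) (N → X)} [IsFiniteKernel α]
  (hN : ∀ w ∈ N, -w ∈ N) (W : Set (Lattice d))

/-- An approximation of `P_{kt}`, where `k` is the length of `L`: a product of partial sums of the
exponential series of `t G^W`, whose numbers of terms are listed in `L`. -/
noncomputable def stepProd (α : Kernel (N → X) (N → X)) [IsFiniteKernel α]
    (hN : ∀ w ∈ N, -w ∈ N) (W : Set (Lattice d)) (t : ℝ) : List ℕ →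
    Module.End ℝ (localAlgebra d X)
  | [] => 1
  | n :: L => stepProd α hN W t L * expSum α hN W t n

theorem dependsOn_stepProd (hN0 : 0 ∈ N) (t : ℝ) (L : List ℕ) {S : Finset (Lattice d)}
    {f : localAlgebra d X} (hf : DependsOn f (S : Set (Lattice d))) :
    DependsOn (stepProd α hN W t L f) (thicken N (2 * L.sum) S : Set (Lattice d)) := by
  induction L generalizing S f with
  | nil => simpa [stepProd] using hf
  | cons n L ih =>
    have h := ih (dependsOn_expSum (α := α) hN W hN0 t hf n)
    rwa [← thicken_add, ← Module.End.mul_apply, ← Nat.mul_add, Nat.add_comm,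
      ← List.sum_cons] at h

variable {W} in
theorem genEnd_pow_congr (hN0 : 0 ∈ N) {W' : Set (Lattice d)} {S : Finset (Lattice d)}
    {f : localAlgebra d X} (hf : DependsOn f (S : Set (Lattice d))) (n : ℕ)
    (h : ∀ v ∈ thicken N (2 * n) S, v ∈ W ↔ v ∈ W') :
    (genEnd α hN W ^ n) f = (genEnd α hN W' ^ n) f := by
  induction n with
  | zero => rfl
  | succ n ih =>
    rw [pow_succ', Module.End.mul_apply, pow_succ', Module.End.mul_apply,
      ← ih fun v hv => h v (thicken_mono_left hN0 (by omega) S hv)]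
    refine genEnd_congr hN W (dependsOn_genEnd_pow hN W hN0 hf n) fun v hv => h v ?_
    rw [← thicken_succ'] at hv
    exact thicken_mono_left hN0 (by omega) S hv

variable {W} in
theorem expSum_congr (hN0 : 0 ∈ N) {W' : Set (Lattice d)} (t : ℝ) {S : Finset (Lattice d)}
    {f : localAlgebra d X} (hf : DependsOn f (S : Set (Lattice d))) (n : ℕ)
    (h : ∀ v ∈ thicken N (2 * n) S, v ∈ W ↔ v ∈ W') :
    expSum α hN W t n f = expSum α hN W' t n f := by
  ext x
  simp only [expSum_apply, expTerm_apply]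
  refine Finset.sum_congr rfl fun i hi => ?_
  rw [genEnd_pow_congr hN hN0 hf i fun v hv => h v
    (thicken_mono_left hN0 (by have := Finset.mem_range.1 hi; omega) S hv)]

variable {W} in
theorem stepProd_congr (hN0 : 0 ∈ N) {W' : Set (Lattice d)} (t : ℝ) (L : List ℕ)
    {S : Finset (Lattice d)} {f : localAlgebra d X} (hf : DependsOn f (S : Set (Lattice d)))
    (h : ∀ v ∈ thicken N (2 * L.sum) S, v ∈ W ↔ v ∈ W') :
    stepProd α hN W t L f = stepProd α hN W' t L f := by
  induction L generalizing S f with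
  | nil => rfl
  | cons n L ih =>
    rw [List.sum_cons] at h
    rw [stepProd, stepProd, Module.End.mul_apply, Module.End.mul_apply,
      ← expSum_congr hN hN0 t hf n fun v hv => h v (thicken_mono_left hN0 (by omega) S hv)]
    refine ih (dependsOn_expSum hN W hN0 t hf n) fun v hv => h v ?_
    rwa [← thicken_add, ← Nat.mul_add, Nat.add_comm] at hv

/-- An empty partial sum would send `1` to `0`, hence the condition on `L`. With `1` as second
factor, estimates for products become estimates for single expectations. -/
theorem stepProd_one (t : ℝ) (L : List ℕ) (hL : ∀ n ∈ L, n ≠ 0) :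
    stepProd α hN W t L 1 = 1 := by
  induction L with
  | nil => rfl
  | cons n L ih =>
    have h1 : expSum α hN W t n 1 = 1 := by
      obtain ⟨n, rfl⟩ := Nat.exists_eq_succ_of_ne_zero (hL n (by simp))
      have hG : genEnd α hN W 1 = 0 := by
        ext x
        rw [coe_genEnd]
        simp [generator, siteGenerator]
      ext x
      rw [expSum_apply, Finset.sum_range_succ']
      simp [expTerm_apply, pow_succ _ _, hG]
    rw [stepProd, Module.End.mul_apply, h1, ih fun k hk => hL k (by simp [hk])]

end StepProd

/-! ### Translation covariance. -/

section Translate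

variable {d : ℕ} {X : Type*}

/-- The configuration `x` seen from the site `u`. -/
def shift (u : Lattice d) (x : Lattice d → X) : Lattice d → X := fun w => x (w + u)

variable {N : Finset (Lattice d)}

theorem window_shift (u v : Lattice d) (x : Lattice d → X) :
    window N v (shift u x) = window N (v + u) x := by
  ext w
  simp only [window, shift, add_assoc]

theorem shift_glue (u v : Lattice d) (x : Lattice d → X) (y : N → X) :
    shift u (glue N (v + u) x y) = glue N v (shift u x) y := by
  ext w
  simp only [glue, shift, add_sub_add_right_eq_sub]

variable [MeasurableSpace X]

theorem measurable_shift (u : Lattice d) : Measurable (shift u : (Lattice d → X) → _) :=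
  measurable_pi_lambda _ fun _ => measurable_pi_apply _

/-- The translation of local functions. -/
def translate (u : Lattice d) : localAlgebra d X →ₗ[ℝ] localAlgebra d X where
  toFun f := ⟨fun x => f (shift u x), by
    obtain ⟨hf, ⟨B, hB⟩, S, hS⟩ := f.2
    refine ⟨hf.comp (measurable_shift u), ⟨B, fun x => hB _⟩, S.image (· + u), fun x y h =>
      hS fun w hw => h _ ?_⟩
    simpa using hw⟩
  map_add' _ _ := rfl
  map_smul' _ _ := rfl

theorem translate_apply (u : Lattice d) (f : localAlgebra d X) (x : Lattice d → X) :
    translate u f x = f (shift u x) := rfl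

variable {α : Kernel (N → X) (N → X)}

theorem siteGenerator_shift (u v : Lattice d) (f : (Lattice d → X) → ℝ) (x : Lattice d → X) :
    siteGenerator N α (v + u) (fun x => f (shift u x)) x = siteGenerator N α v f (shift u x) := by
  simp only [siteGenerator, shift_glue, window_shift]

theorem generator_shift (W : Set (Lattice d)) (u : Lattice d) (f : (Lattice d → X) → ℝ)
    (x : Lattice d → X) :
    generator N α W (fun x => f (shift u x)) x
      = generator N α ((· + u) ⁻¹' W) f (shift u x) := by
  refine (finsum_mem_eq_of_bijOn (· + u) ⟨fun v hv => hv, (add_left_injective u).injOn,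
    fun v hv => ⟨v - u, ?_, ?_⟩⟩ fun v _ => (siteGenerator_shift u v f x).symm).symm
  · change v - u + u ∈ W
    simpa using hv
  · simp

variable [IsFiniteKernel α] (hN : ∀ w ∈ N, -w ∈ N) (W : Set (Lattice d))

theorem genEnd_translate (u : Lattice d) (f : localAlgebra d X) :
    genEnd α hN W (translate u f) = translate u (genEnd α hN ((· + u) ⁻¹' W) f) :=
  Subtype.ext (funext fun x => generator_shift W u f x)

theorem genEnd_pow_translate (u : Lattice d) (n : ℕ) (f : localAlgebra d X) :
    (genEnd α hN W ^ n) (translate u f) = translate u ((genEnd α hN ((· + u) ⁻¹' W) ^ n) f) := by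
  induction n with
  | zero => rfl
  | succ n ih =>
    rw [pow_succ', Module.End.mul_apply, ih, genEnd_translate, pow_succ', Module.End.mul_apply]

theorem expSum_translate (u : Lattice d) (t : ℝ) (n : ℕ) (f : localAlgebra d X) :
    expSum α hN W t n (translate u f) = translate u (expSum α hN ((· + u) ⁻¹' W) t n f) := by
  ext x
  simp only [translate_apply, expSum_apply, expTerm_apply, genEnd_pow_translate]

theorem stepProd_translate (u : Lattice d) (t : ℝ) (L : List ℕ) (f : localAlgebra d X) :
    stepProd α hN W t L (translate u f) = translate u (stepProd α hN ((· + u) ⁻¹' W) t L f) := by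
  induction L generalizing f with
  | nil => rfl
  | cons n L ih =>
    rw [stepProd, Module.End.mul_apply, expSum_translate, ih, stepProd, Module.End.mul_apply]

end Translate

/-! ### Approximate multiplicativity of the semigroup. -/

section Approximation

variable {d : ℕ} {X : Type*} [MeasurableSpace X] {N : Finset (Lattice d)}
  {α : Kernel (N → X) (N → X)} [IsFiniteKernel α]
  (hN : ∀ w ∈ N, -w ∈ N)

theorem abs_semigroup_mul_sub_le (hN0 : 0 ∈ N) {c : ℝ≥0} (hα : ∀ x, α x Set.univ ≤ c) {t : ℝ≥0}
    (ht0 : 0 < (t : ℝ)) (ht : (t : ℝ) * (8 * c * N.card ^ 2) ≤ 1) {W : Set (Lattice d)}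
    {μ : ℝ≥0 → Kernel (Lattice d → X) (Lattice d → X)} (hμ : IsMarkovianFamily μ)
    (hgen : HasGeneratorOn μ (localFunctions d X) (generator N α W)) (n : ℕ) {s : ℕ}
    {S T : Finset (Lattice d)} (hs : S.card ≤ s) (hs' : T.card ≤ s) {f g : localAlgebra d X}
    (hf : DependsOn f (S : Set (Lattice d))) (hg : DependsOn g (T : Set (Lattice d)))
    {B : ℝ} (hB : ∀ x, |f x| ≤ B) (hB' : ∀ x, |g x| ≤ B)
    (h : Disjoint (thicken N (2 * n) S) (thicken N (2 * n) T)) (x : Lattice d → X) :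
    |semigroup μ t (f * g : localAlgebra d X) x
        - expSum α hN W t n f x * expSum α hN W t n g x|
      ≤ ((n : ℝ) ^ 2 + 1) * (B * 2 ^ s) ^ 2 * (1 / 2) ^ n := by
  have hB0 : 0 ≤ B := (abs_nonneg _).trans (hB x)
  have hfg : DependsOn (f * g : localAlgebra d X) ((S ∪ T : Finset (Lattice d)) :
      Set (Lattice d)) := by
    intro x y h
    rw [Subalgebra.coe_mul, Pi.mul_apply, Pi.mul_apply, hf fun i hi => h i (by simp_all),
      hg fun i hi => h i (by simp_all)]
  have hBB : ∀ x, |(f * g : localAlgebra d X) x| ≤ B * B := fun x => by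
    rw [Subalgebra.coe_mul, Pi.mul_apply, abs_mul]
    exact mul_le_mul (hB x) (hB' x) (abs_nonneg _) hB0
  have hcard : (S ∪ T).card ≤ s + s := (Finset.card_union_le _ _).trans (add_le_add hs hs')
  have htn : 0 < (t : ℝ) ^ n / n.factorial := by positivity
  have h1 : |semigroup μ t (f * g : localAlgebra d X) x - expSum α hN W t n (f * g) x|
      ≤ B * B * 2 ^ (s + s) * (1 / 2) ^ n := by
    -- This `C` bounds `G^n (f g)` and turns Taylor's remainder into the geometric bound; dividing
    -- by `t^n` requires `t > 0`.
    refine (abs_semigroup_sub_expSum_le hN hμ hgen n (f * g)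
      (C := B * B * 2 ^ (s + s) * (1 / 2) ^ n / (t ^ n / n.factorial)) (fun x => ?_) t x).trans
      (mul_div_cancel₀ _ htn.ne').le
    rw [le_div_iff₀' htn]
    exact mul_abs_genEnd_pow_le hN W hN0 hα t.2 ht n hcard hfg hBB x
  have h2 := abs_expSum_mul_sub_le hN W hN0 hα t.2 ht n hs hs' hf hg hB hB' h x
  refine (abs_sub_le _ (expSum α hN W t n (f * g) x) _).trans ((add_le_add h1 h2).trans_eq ?_)
  rw [pow_add]
  ring

/-- `P_{kt}` is approximated by `stepProd`, uniformly in `W`, on all local functions with given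
bounds on their size and the size of their support, and the approximation is multiplicative for
functions with supports far apart. -/
theorem exists_stepProd (hN0 : 0 ∈ N) {c : ℝ≥0} (hα : ∀ x, α x Set.univ ≤ c) {t : ℝ≥0}
    (ht0 : 0 < (t : ℝ)) (ht : (t : ℝ) * (8 * c * N.card ^ 2) ≤ 1) (k s : ℕ) (B : ℝ) {ε : ℝ} (hε : 0 < ε) :
    ∃ L : List ℕ, (∀ n ∈ L, n ≠ 0) ∧ ∀ (W : Set (Lattice d))
      (μ : ℝ≥0 → Kernel (Lattice d → X) (Lattice d → X)), IsMarkovianFamily μ →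
      HasGeneratorOn μ (localFunctions d X) (generator N α W) →
      ∀ (S T : Finset (Lattice d)), S.card ≤ s → T.card ≤ s → ∀ f g : localAlgebra d X,
      DependsOn f (S : Set (Lattice d)) → DependsOn g (T : Set (Lattice d)) →
      (∀ x, |f x| ≤ B) → (∀ x, |g x| ≤ B) →
      Disjoint (thicken N (2 * L.sum) S) (thicken N (2 * L.sum) T) → ∀ x,
      |semigroup μ (k • t) (f * g : localAlgebra d X) x
        - stepProd α hN W t L f x * stepProd α hN W t L g x| ≤ ε := by
  induction k generalizing s B ε with
  | zero =>
    refine ⟨[], by simp, fun W μ hμ _ S T _ _ f g _ _ _ _ _ x => ?_⟩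
    rw [zero_smul, hμ.semigroup_zero (localAlgebra.measurable _)]
    simp [stepProd, hε.le]
  | succ k ih =>
    have hlim : Tendsto (fun n : ℕ => ((n : ℝ) ^ 2 + 1) * (B * 2 ^ s) ^ 2 * (1 / 2) ^ n)
        atTop (𝓝 0) := by
      have h2 := tendsto_pow_const_mul_const_pow_of_abs_lt_one 2 (r := (1 / 2 : ℝ))
        (by rw [abs_of_pos] <;> norm_num)
      have h0 := tendsto_pow_const_mul_const_pow_of_abs_lt_one 0 (r := (1 / 2 : ℝ))
        (by rw [abs_of_pos] <;> norm_num)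
      have := (h2.add h0).const_mul ((B * 2 ^ s) ^ 2)
      simp only [add_zero, mul_zero] at this
      exact this.congr fun n => by ring
    -- In `P_{kt} P_t`, the factor `P_t` is replaced by a partial sum of `n` terms. Its bounds on
    -- size and support depend on `n`, `s`, `B` and `|N|` but not on `W`, so the induction
    -- hypothesis can be invoked before `W` is given.
    obtain ⟨n, hn, hn0⟩ := ((hlim.eventually (ge_mem_nhds (half_pos hε))).and
      (eventually_ne_atTop 0)).exists
    obtain ⟨L, hL0, hL⟩ := ih (s * N.card ^ (2 * n)) (n * (B * 2 ^ s)) (half_pos hε)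
    refine ⟨n :: L, by simpa using ⟨hn0, hL0⟩, fun W μ hμ hgen S T hs hs' f g hf hg hB hB' h x => ?_⟩
    rw [List.sum_cons, Nat.mul_add, Nat.add_comm] at h
    have hcard (U : Finset (Lattice d)) (hU : U.card ≤ s) :
        (thicken N (2 * n) U).card ≤ s * N.card ^ (2 * n) :=
      (card_thicken_le _ _).trans (Nat.mul_le_mul_right _ hU)
    have h1 := abs_semigroup_mul_sub_le hN hN0 hα ht0 ht hμ hgen n hs hs' hf hg hB hB'
      (h.mono (thicken_mono_left hN0 (by omega) S) (thicken_mono_left hN0 (by omega) T))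
    have h2 := hL W μ hμ hgen _ _ (hcard S hs) (hcard T hs') (expSum α hN W t n f)
      (expSum α hN W t n g) (dependsOn_expSum hN W hN0 t hf n) (dependsOn_expSum hN W hN0 t hg n)
      (abs_expSum_apply_le hN W hN0 hα t.2 ht n hs hf hB)
      (abs_expSum_apply_le hN W hN0 hα t.2 ht n hs' hg hB')
      (by rwa [← thicken_add, ← thicken_add]) x
    obtain ⟨C, hC⟩ := localAlgebra.exists_bound (f * g)
    obtain ⟨D, hD⟩ := localAlgebra.exists_bound (expSum α hN W t n f * expSum α hN W t n g)
    have h3 : |semigroup μ (k • t) (semigroup μ t (f * g : localAlgebra d X)) x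
        - semigroup μ (k • t) (expSum α hN W t n f * expSum α hN W t n g : localAlgebra d X) x|
        ≤ ε / 2 := by
      rw [← semigroup_sub hμ _ (measurable_semigroup hμ t (localAlgebra.measurable _))
        (abs_semigroup_le hμ t hC) (localAlgebra.measurable _) hD]
      exact abs_semigroup_le hμ _ (fun y => (h1 y).trans hn) x
    rw [succ_nsmul, semigroup_add hμ _ _ (localAlgebra.measurable _) hC]
    simp only [stepProd, Module.End.mul_apply]
    exact (abs_sub_le _ _ _).trans ((add_le_add h3 h2).trans_eq (add_halves ε))

end Approximation

/-! ### Laws at time `τ` and approximate factorisation of expectations. -/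

section Law

variable {d : ℕ} {X : Type*} [MeasurableSpace X] {N : Finset (Lattice d)}
  {α : Kernel (N → X) (N → X)}

/-- `ρ` is the distribution at time `τ` of the process with generator `G^W` and with independent
initial states with distribution `ν`. -/
def IsLawAt (N : Finset (Lattice d)) (α : Kernel (N → X) (N → X)) (W : Set (Lattice d))
    (ν : Measure X) [IsProbabilityMeasure ν] (τ : ℝ≥0) (ρ : Measure (Lattice d → X)) : Prop :=
  ∃ μ : ℝ≥0 → Kernel (Lattice d → X) (Lattice d → X), IsMarkovianFamily μ ∧
    HasGeneratorOn μ (localFunctions d X) (generator N α W) ∧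
    ρ = (Measure.infinitePi fun _ => ν).bind (μ τ)

variable {ν : Measure X} [IsProbabilityMeasure ν] {W : Set (Lattice d)} {τ : ℝ≥0}

theorem IsLawAt.isProbabilityMeasure {ρ : Measure (Lattice d → X)}
    (h : IsLawAt N α W ν τ ρ) : IsProbabilityMeasure ρ := by
  obtain ⟨μ, hμ, -, rfl⟩ := h
  have := hμ.markov τ
  infer_instance

section Realization

variable [TopologicalSpace X] {Ω : Type*} [MeasurableSpace Ω] {P : Measure Ω}
  {ξ : ℝ≥0 → Ω → Lattice d → X}

theorem IsMarkovProcess.measurable {μ : ℝ≥0 → Kernel (Lattice d → X) (Lattice d → X)}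
    (h : IsMarkovProcess P μ ξ) (t : ℝ≥0) : Measurable (ξ t) := by
  obtain ⟨𝒢, h𝒢, -⟩ := h.markov
  exact (h𝒢 t).mono (𝒢.le t) le_rfl

/-- This is the Markov property at time zero, integrated. -/
theorem IsMarkovProcess.map_eq_bind [IsProbabilityMeasure P]
    {μ : ℝ≥0 → Kernel (Lattice d → X) (Lattice d → X)}
    (hμ : IsMarkovianFamily μ) (h : IsMarkovProcess P μ ξ) (t : ℝ≥0) :
    P.map (ξ t) = (P.map (ξ 0)).bind (μ t) := by
  have := hμ.markov t
  obtain ⟨𝒢, h𝒢, hB⟩ := h.markov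
  ext B hBm
  have h0 := h.measurable 0
  have hm : Measurable fun ω => μ t (ξ 0 ω) B := ((μ t).measurable_coe hBm).comp h0
  rw [Measure.map_apply (h.measurable t) hBm, Measure.bind_apply hBm (μ t).aemeasurable,
    lintegral_map ((μ t).measurable_coe hBm) h0]
  have h1 : ∫ ω, (μ t (ξ 0 ω)).real B ∂P = P.real (ξ t ⁻¹' B) := by
    rw [← integral_congr_ae (hB 0 t B hBm), integral_condExp, zero_add,
      integral_indicator (h.measurable t hBm)]
    simp
  have h2 : ∫ ω, (μ t (ξ 0 ω)).real B ∂P = (∫⁻ ω, μ t (ξ 0 ω) B ∂P).toReal :=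
    integral_toReal hm.aemeasurable (ae_of_all _ fun _ => measure_lt_top _ _)
  rw [← ENNReal.toReal_eq_toReal_iff' (measure_ne_top _ _), ← h2, h1]
  · rfl
  · refine ((lintegral_mono fun _ => prob_le_one).trans_lt ?_).ne (b := ∞)
    simp

theorem IsRealization.measurable {ν : Measure X} (h : IsRealization N α W ν P ξ) (t : ℝ≥0) :
    Measurable (ξ t) := by
  obtain ⟨μ, -, -, hξ⟩ := h.process
  exact hξ.measurable t

theorem IsRealization.isLawAt [IsProbabilityMeasure P] (h : IsRealization N α W ν P ξ) (τ : ℝ≥0) :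
    IsLawAt N α W ν τ (P.map (ξ τ)) := by
  obtain ⟨μ, hμ, hgen, hξ⟩ := h.process
  refine ⟨μ, hμ, hgen, ?_⟩
  rw [hξ.map_eq_bind hμ τ]
  congr 1
  have := (iIndepFun_iff_map_fun_eq_infinitePi_map
    fun v => (measurable_pi_apply v).comp (hξ.measurable 0)).1 h.initial_indep
  simp only [Function.comp_def, h.initial_law] at this
  exact this

end Realization

theorem integral_bind_eq {μ : ℝ≥0 → Kernel (Lattice d → X) (Lattice d → X)}
    (hμ : IsMarkovianFamily μ) (τ : ℝ≥0) (π : Measure (Lattice d → X)) [IsProbabilityMeasure π]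
    (f : localAlgebra d X) : ∫ x, f x ∂(π.bind (μ τ)) = ∫ x, semigroup μ τ f x ∂π := by
  have := hμ.markov τ
  have hi := localAlgebra.integrable f (π.bind (μ τ))
  rw [Measure.comp_eq_comp_const_apply] at hi ⊢
  rw [Kernel.integral_comp hi]
  rfl

theorem map_shift_infinitePi (u : Lattice d) :
    (Measure.infinitePi fun _ : Lattice d => ν).map (shift u) = Measure.infinitePi fun _ => ν :=
  Measure.map_infinitePi_infinitePi_of_inj (P := fun _ : Lattice d => ν) (add_left_injective u)

theorem integral_translate (u : Lattice d) (f : localAlgebra d X) :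
    ∫ x, translate u f x ∂(Measure.infinitePi fun _ => ν)
      = ∫ x, f x ∂(Measure.infinitePi fun _ => ν) := by
  conv_rhs => rw [← map_shift_infinitePi u]
  rw [integral_map (measurable_shift u).aemeasurable
    (localAlgebra.measurable f).aestronglyMeasurable]
  rfl

/-- Outside `S` the configuration is filled with a fixed state, which `f` does not notice. -/
theorem exists_measurable_restrict_comp {S : Finset (Lattice d)} {f : localAlgebra d X}
    (hf : DependsOn f (S : Set (Lattice d))) [Nonempty X] :
    ∃ g : (S → X) → ℝ, Measurable g ∧ ∀ x, f x = g (fun i : S => x i) := by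
  classical
  let x₀ : X := Classical.arbitrary X
  refine ⟨fun y => f fun w => if h : w ∈ S then y ⟨w, h⟩ else x₀,
    (localAlgebra.measurable f).comp (measurable_pi_lambda _ fun w => ?_),
    fun x => hf fun w hw => ?_⟩
  · by_cases h : w ∈ S
    · simpa only [h, dif_pos] using measurable_pi_apply _
    · simpa only [h, dif_neg, not_false_eq_true] using measurable_const
  · have : w ∈ S := hw
    simp [this]

theorem integral_mul_infinitePi {S T : Finset (Lattice d)} (h : Disjoint S T)
    {f g : localAlgebra d X} (hf : DependsOn f (S : Set (Lattice d)))
    (hg : DependsOn g (T : Set (Lattice d))) :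
    ∫ x, f x * g x ∂(Measure.infinitePi fun _ => ν)
      = (∫ x, f x ∂(Measure.infinitePi fun _ => ν))
        * ∫ x, g x ∂(Measure.infinitePi fun _ => ν) := by
  have : Nonempty X := nonempty_of_isProbabilityMeasure ν
  obtain ⟨f', hf'm, hf'⟩ := exists_measurable_restrict_comp hf
  obtain ⟨g', hg'm, hg'⟩ := exists_measurable_restrict_comp hg
  have hi := (iIndepFun_infinitePi (P := fun _ : Lattice d => ν) (X := fun _ x => x)
    fun _ => measurable_id).indepFun_finset S T h fun i => measurable_pi_apply i
  simp only [hf', hg']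
  exact hi.integral_comp_mul_comp (measurable_pi_lambda _ fun _ => measurable_pi_apply _).aemeasurable
    (measurable_pi_lambda _ fun _ => measurable_pi_apply _).aemeasurable
    hf'm.aestronglyMeasurable hg'm.aestronglyMeasurable

/-- The expectations of products of two local functions with supports far apart factorise up to
`ε`, into numbers that depend only on `W` near the supports, and that are translation covariant. -/
theorem exists_approx_expectation (hN0 : 0 ∈ N) (hN : ∀ w ∈ N, -w ∈ N)
    (hα : ∃ c : ℝ≥0, ∀ x, α x Set.univ ≤ c) (ν : Measure X) [IsProbabilityMeasure ν]
    (hτ : 0 < τ) (s : ℕ) (B : ℝ) {ε : ℝ} (hε : 0 < ε) :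
    ∃ (R : ℕ) (m : Set (Lattice d) → localAlgebra d X → ℝ),
      (∀ W W' (S : Finset (Lattice d)) (f : localAlgebra d X),
        DependsOn f (S : Set (Lattice d)) → (∀ v ∈ thicken N R S, v ∈ W ↔ v ∈ W') →
        m W f = m W' f) ∧
      (∀ W u f, m W (translate u f) = m ((· + u) ⁻¹' W) f) ∧ (∀ W, m W 1 = 1) ∧
      ∀ W (ρ : Measure (Lattice d → X)), IsLawAt N α W ν τ ρ →
      ∀ (S T : Finset (Lattice d)), S.card ≤ s → T.card ≤ s → ∀ f g : localAlgebra d X,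
      DependsOn f (S : Set (Lattice d)) → DependsOn g (T : Set (Lattice d)) →
      (∀ x, |f x| ≤ B) → (∀ x, |g x| ≤ B) → Disjoint (thicken N R S) (thicken N R T) →
      |∫ x, f x * g x ∂ρ - m W f * m W g| ≤ ε := by
  obtain ⟨c, hc⟩ := hα
  have : IsFiniteKernel α := ⟨c, ENNReal.coe_lt_top, hc⟩
  obtain ⟨k, hk⟩ := exists_nat_ge ((τ : ℝ) * (8 * c * N.card ^ 2))
  -- A step this short makes the series converge geometrically.
  set t : ℝ≥0 := τ / (k + 1 : ℕ) with ht_def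
  have ht0 : (0 : ℝ) < t := by
    rw [NNReal.coe_pos, ht_def]
    positivity
  have hkt : (k + 1) • t = τ := by
    rw [nsmul_eq_mul, ht_def, mul_div_cancel₀]
    positivity
  have ht : (t : ℝ) * (8 * c * N.card ^ 2) ≤ 1 := by
    rw [ht_def]
    push_cast
    rw [div_mul_eq_mul_div, div_le_one (by positivity)]
    linarith
  obtain ⟨L, hL0, hL⟩ := exists_stepProd hN hN0 hc ht0 ht (k + 1) s B hε
  set π : Measure (Lattice d → X) := Measure.infinitePi fun _ => ν
  -- `m W f` is the initial expectation of the finite-range approximation of `P_τ f`.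
  refine ⟨2 * L.sum, fun W f => ∫ x, stepProd α hN W t L f x ∂π, ?_, ?_, ?_, ?_⟩
  · intro W W' S f hf h
    simp only [stepProd_congr hN hN0 t L hf h]
  · intro W u f
    simp only [stepProd_translate]
    exact integral_translate u _
  · intro W
    simp [stepProd_one hN W t L hL0]
  · rintro W _ ⟨μ, hμ, hgen, rfl⟩ S T hS hT f g hf hg hB hB' h
    have key := hL W μ hμ hgen S T hS hT f g hf hg hB hB' h
    rw [hkt] at key
    have hμτ := hμ.markov τ
    obtain ⟨C, hC⟩ := localAlgebra.exists_bound (f * g)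
    have hi1 : Integrable (semigroup μ τ (f * g : localAlgebra d X)) π :=
      .of_bound (measurable_semigroup hμ τ (localAlgebra.measurable _)).aestronglyMeasurable C
        (ae_of_all _ (abs_semigroup_le hμ τ hC))
    have hi2 := localAlgebra.integrable (stepProd α hN W t L f * stepProd α hN W t L g) π
    have e1 : ∫ x, f x * g x ∂(π.bind (μ τ)) = _ := integral_bind_eq hμ τ π (f * g)
    -- The two approximations depend on disjoint sets of sites, so under the product law they
    -- factorise exactly.
    have e2 := integral_mul_infinitePi (ν := ν) h (dependsOn_stepProd (α := α) hN W hN0 t L hf)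
      (dependsOn_stepProd (α := α) hN W hN0 t L hg)
    have e3 := integral_sub hi1 hi2
    simp only [Subalgebra.coe_mul, Pi.mul_apply] at e3
    rw [e1, ← e2, Subalgebra.coe_mul, ← e3]
    have key' : ∀ x, ‖semigroup μ τ ((f : (Lattice d → X) → ℝ) * g) x
        - stepProd α hN W t L f x * stepProd α hN W t L g x‖ ≤ ε := key
    simpa using norm_integral_le_of_norm_le_const (μ := π) (ae_of_all _ key')

end Law

/-! ### Geometry of the boundary. -/

section Boundary

variable {d : ℕ} {N : Finset (Lattice d)}

theorem extBoundary_coe (N A : Finset (Lattice d)) :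
    extBoundary N (A : Set (Lattice d)) = (((A + N) \ A : Finset (Lattice d)) :
      Set (Lattice d)) := by
  ext w
  simp only [extBoundary, nbhdSet, nbhd, Set.mem_sdiff, Set.mem_iUnion, Set.mem_image,
    Finset.coe_sdiff, Finset.mem_coe, Finset.mem_add, exists_prop]

/-- A path from `u` that leaves `A` passes through a boundary site, and by symmetry of `N` it can be
walked back from there. -/
theorem exists_mem_boundary (hN0 : 0 ∈ N) (hN : ∀ w ∈ N, -w ∈ N) {A : Finset (Lattice d)}
    {u : Lattice d} (hu : u ∈ A) (k : ℕ) {w : Lattice d} (hw : w ∈ thicken N k {u})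
    (hwA : w ∉ A) : u ∈ thicken N k ((A + N) \ A) := by
  induction k generalizing w with
  | zero =>
    obtain rfl : w = u := by simpa using hw
    exact absurd hu hwA
  | succ k ih =>
    rw [thicken_succ', Finset.mem_add] at hw
    obtain ⟨z, hz, n, hn, rfl⟩ := hw
    by_cases hzA : z ∈ A
    · have hb : z + n ∈ (A + N) \ A :=
        Finset.mem_sdiff.2 ⟨Finset.mem_add.2 ⟨z, hzA, n, hn, rfl⟩, hwA⟩
      refine thicken_mono (k + 1) (Finset.singleton_subset_iff.2 hb) (mem_thicken_comm hN ?_)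
      rw [thicken_succ']
      exact Finset.mem_add.2 ⟨z, hz, n, hn, rfl⟩
    · exact thicken_mono_left hN0 k.le_succ _ (ih hz hzA)

/-- Unless there is no interaction, every finite non-empty set has a boundary. -/
theorem boundary_nonempty (hN0 : 0 ∈ N) (hN1 : N ≠ {0}) {A : Finset (Lattice d)}
    (hA : A.Nonempty) : ((A + N) \ A).Nonempty := by
  obtain ⟨w, hw, hw0⟩ : ∃ w ∈ N, w ≠ 0 := by
    by_contra! h
    exact hN1 (Finset.eq_singleton_iff_unique_mem.2 ⟨hN0, h⟩)
  by_contra hne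
  rw [Finset.not_nonempty_iff_eq_empty, Finset.sdiff_eq_empty_iff_subset] at hne
  obtain ⟨v, hv⟩ := hA
  -- Without a boundary, the finite set `A` would contain an infinite half-line.
  have hmem : ∀ k : ℕ, v + k • w ∈ A := by
    intro k
    induction k with
    | zero => simpa using hv
    | succ k ih =>
      rw [succ_nsmul, ← add_assoc]
      exact hne (Finset.mem_add.2 ⟨_, ih, w, hw, rfl⟩)
  obtain ⟨i, hi⟩ := Function.ne_iff.1 hw0
  refine not_injective_infinite_finite (fun k : ℕ => (⟨v + k • w, hmem k⟩ : A)) fun k l h => ?_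
  have h' := congrFun (Subtype.ext_iff.1 h) i
  simpa [show w i ≠ 0 from hi] using h'

end Boundary

/-! ### Functions of a window. -/

section Window

variable {d : ℕ} {X : Type*} [MeasurableSpace X] {N : Finset (Lattice d)}

/-- A bounded measurable function of the pattern in `N`, as a local function. -/
def ofWindow {h : (N → X) → ℝ} (hh : Measurable h) {B : ℝ} (hB : ∀ y, |h y| ≤ B) :
    localAlgebra d X :=
  ⟨fun x => h (N.restrict x), hh.comp (Finset.measurable_restrict N), ⟨B, fun _ => hB _⟩, N,
    fun _ _ hxy => congrArg h (funext fun i => hxy i i.2)⟩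

variable {h : (N → X) → ℝ} (hh : Measurable h) {B : ℝ} (hB : ∀ y, |h y| ≤ B)

theorem translate_ofWindow_apply (u : Lattice d) (x : Lattice d → X) :
    translate u (ofWindow hh hB) x = h (window N u x) := rfl

theorem dependsOn_translate_ofWindow (u : Lattice d) :
    DependsOn (translate u (ofWindow hh hB)) (({u} + N : Finset (Lattice d)) :
      Set (Lattice d)) := by
  intro x y hxy
  rw [translate_ofWindow_apply, translate_ofWindow_apply]
  congr 1
  ext w
  refine hxy _ (Finset.mem_add.2 ⟨u, by simp, w, w.2, add_comm _ _⟩)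

theorem dependsOn_ofWindow : DependsOn (ofWindow hh hB) (N : Set (Lattice d)) :=
  fun _ _ hxy => congrArg h (funext fun i => hxy i i.2)

end Window

/-! ### Comparison of laws and the second moment. -/

section Moments

variable {d : ℕ} {X : Type*} [MeasurableSpace X] {N : Finset (Lattice d)}
  {α : Kernel (N → X) (N → X)} {ν : Measure X} [IsProbabilityMeasure ν] {τ : ℝ≥0}

/-- The laws of the patterns in `N` under the process for `W - u` and in `u + N` under the process
for `W` coincide. -/
theorem IsLawAt.map_window_eq (hN0 : 0 ∈ N) (hN : ∀ w ∈ N, -w ∈ N)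
    (hα : ∃ c : ℝ≥0, ∀ x, α x Set.univ ≤ c) (hτ : 0 < τ) {W : Set (Lattice d)} (u : Lattice d)
    {ρ ρ' : Measure (Lattice d → X)} (hρ : IsLawAt N α W ν τ ρ)
    (hρ' : IsLawAt N α ((· + u) ⁻¹' W) ν τ ρ') :
    ρ.map (window N u) = ρ'.map N.restrict := by
  have := hρ.isProbabilityMeasure
  have := hρ'.isProbabilityMeasure
  have := Measure.isProbabilityMeasure_map (μ := ρ)
    (measurable_window (N := N) (X := X) u).aemeasurable
  have := Measure.isProbabilityMeasure_map (μ := ρ')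
    (Finset.measurable_restrict (X := fun _ => X) N).aemeasurable
  refine Measure.ext fun D hD => (measureReal_eq_measureReal_iff).1 ?_
  rw [map_measureReal_apply (measurable_window u) hD,
    map_measureReal_apply (Finset.measurable_restrict N) hD]
  have hh : Measurable (D.indicator fun _ => (1 : ℝ)) := measurable_const.indicator hD
  have hB : ∀ y, |D.indicator (fun _ => (1 : ℝ)) y| ≤ 1 := fun y => by
    by_cases hy : y ∈ D <;> simp [hy]
  set f : localAlgebra d X := ofWindow hh hB
  have e1 : ∫ x, translate u f x ∂ρ = ρ.real (window N u ⁻¹' D) := by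
    rw [← integral_indicator_one (measurable_window u hD)]
    rfl
  have e2 : ∫ x, f x ∂ρ' = ρ'.real (N.restrict ⁻¹' D) := by
    rw [← integral_indicator_one (Finset.measurable_restrict N hD)]
    rfl
  rw [← e1, ← e2]
  -- The translation rule for `m` puts both probabilities within `ε / 2` of the same number.
  refine eq_of_forall_dist_le fun ε hε => ?_
  obtain ⟨R, m, -, hm, hm1, happ⟩ := exists_approx_expectation hN0 hN hα ν hτ N.card 1
    (half_pos hε)
  have h1 : ∀ x : Lattice d → X, |(1 : localAlgebra d X) x| ≤ 1 := fun x => by simp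
  have k1 := happ W ρ hρ ({u} + N) ∅ (Finset.card_add_le.trans (by simp)) (by simp)
    (translate u f) 1 (dependsOn_translate_ofWindow hh hB u) (fun _ _ _ => rfl) (fun x => hB _) h1
    (by simp)
  have k2 := happ _ ρ' hρ' N ∅ le_rfl (by simp) f 1 (dependsOn_ofWindow hh hB)
    (fun _ _ _ => rfl) (fun x => hB _) h1 (by simp)
  simp only [hm, hm1, Subalgebra.coe_one, Pi.one_apply, mul_one] at k1 k2
  rw [abs_sub_comm] at k2
  rw [Real.dist_eq]
  exact (abs_sub_le _ _ _).trans ((add_le_add k1 k2).trans_eq (add_halves ε))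

/-- For `A` the `R`-step neighbourhood of the window, `m` cannot tell `A` from the whole lattice. -/
theorem exists_integral_le_add_of_isLawAt_univ (hN0 : 0 ∈ N) (hN : ∀ w ∈ N, -w ∈ N)
    (hα : ∃ c : ℝ≥0, ∀ x, α x Set.univ ≤ c) (hτ : 0 < τ) {ρ : Measure (Lattice d → X)}
    (hρ : IsLawAt N α Set.univ ν τ ρ) {h : (N → X) → ℝ} (hh : Measurable h) {B : ℝ}
    (hB : ∀ y, |h y| ≤ B) {ε : ℝ} (hε : 0 < ε) :
    ∃ A : Finset (Lattice d), A.Nonempty ∧ ∀ ρ', IsLawAt N α A ν τ ρ' →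
      ∫ x, h (N.restrict x) ∂ρ ≤ ∫ x, h (N.restrict x) ∂ρ' + ε := by
  -- The bound `max B 1` admits the constant `1` as second factor.
  obtain ⟨R, m, hmc, -, hm1, happ⟩ := exists_approx_expectation hN0 hN hα ν hτ N.card (max B 1)
    (half_pos hε)
  refine ⟨thicken N R N, ⟨0, subset_thicken hN0 R N hN0⟩, fun ρ' hρ' => ?_⟩
  set f : localAlgebra d X := ofWindow hh hB
  have hf := dependsOn_ofWindow (d := d) hh hB
  have hfB : ∀ x, |f x| ≤ max B 1 := fun x => (hB _).trans (le_max_left _ _)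
  have h1 : ∀ x : Lattice d → X, |(1 : localAlgebra d X) x| ≤ max B 1 := fun x => by simp
  have k1 := happ _ ρ hρ N ∅ le_rfl (by simp) f 1 hf (fun _ _ _ => rfl) hfB h1 (by simp)
  have k2 := happ _ ρ' hρ' N ∅ le_rfl (by simp) f 1 hf (fun _ _ _ => rfl) hfB h1 (by simp)
  rw [hmc _ Set.univ N f hf (by simp)] at k2
  simp only [hm1, Subalgebra.coe_one, Pi.one_apply, mul_one] at k1 k2
  have e1 := (abs_le.1 k1).2
  have e2 := (abs_le.1 k2).1
  change ∫ x, f x ∂ρ ≤ ∫ x, f x ∂ρ' + ε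
  linarith

/-- A moment bound for all finite systems carries over to the infinite system. -/
theorem lintegral_le_of_isLawAt_univ (hN0 : 0 ∈ N) (hN : ∀ w ∈ N, -w ∈ N)
    (hα : ∃ c : ℝ≥0, ∀ x, α x Set.univ ≤ c) (hτ : 0 < τ) {ρ : Measure (Lattice d → X)}
    (hρ : IsLawAt N α Set.univ ν τ ρ) {ρA : Finset (Lattice d) → Measure (Lattice d → X)}
    (hρA : ∀ A : Finset (Lattice d), A.Nonempty → IsLawAt N α A ν τ (ρA A))
    {φ : (N → X) → ℝ≥0∞} (hφ : Measurable φ) {M : ℝ≥0∞}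
    (hM : ∀ A : Finset (Lattice d), A.Nonempty → ∫⁻ x, φ (N.restrict x) ∂(ρA A) ≤ M) :
    ∫⁻ x, φ (N.restrict x) ∂ρ ≤ M := by
  have := hρ.isProbabilityMeasure
  -- The comparison needs bounded functions; monotone convergence removes the cutoff `K`.
  have hmono : Monotone fun (K : ℕ) (x : Lattice d → X) => min (φ (N.restrict x)) (K : ℝ≥0∞) :=
    fun K L hKL x => min_le_min le_rfl (by exact_mod_cast hKL)
  have hmeas (K : ℕ) : Measurable fun y => min (φ y) (K : ℝ≥0∞) := hφ.min measurable_const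
  have hres : Measurable (N.restrict : (Lattice d → X) → N → X) := Finset.measurable_restrict N
  have hmeas' (K : ℕ) : Measurable fun x : Lattice d → X => min (φ (N.restrict x)) (K : ℝ≥0∞) :=
    (hmeas K).comp hres
  have hsup : ∀ x : Lattice d → X, φ (N.restrict x)
      = ⨆ K : ℕ, min (φ (N.restrict x)) (K : ℝ≥0∞) := fun x => by
    rw [← inf_iSup_eq, ENNReal.iSup_natCast, inf_top_eq]
  rw [lintegral_congr hsup, lintegral_iSup hmeas' hmono]
  refine iSup_le fun K => ENNReal.le_of_forall_pos_le_add fun ε hε _ => ?_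
  have hfin (y : N → X) : min (φ y) (K : ℝ≥0∞) ≠ ∞ :=
    ((min_le_right _ _).trans_lt (ENNReal.natCast_lt_top K)).ne
  set h : (N → X) → ℝ := fun y => (min (φ y) (K : ℝ≥0∞)).toReal
  have hh : Measurable h := (hmeas K).ennreal_toReal
  have hB : ∀ y, |h y| ≤ K := fun y => by
    rw [abs_of_nonneg ENNReal.toReal_nonneg]
    exact ENNReal.toReal_le_of_le_ofReal (by positivity) (by simp)
  have hlint (ρ : Measure (Lattice d → X)) [IsProbabilityMeasure ρ] :
      ∫⁻ x, min (φ (N.restrict x)) (K : ℝ≥0∞) ∂ρ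
        = ENNReal.ofReal (∫ x, h (N.restrict x) ∂ρ) := by
    have hi : Integrable (fun x => h (N.restrict x)) ρ :=
      localAlgebra.integrable (ofWindow hh hB) ρ
    rw [ofReal_integral_eq_lintegral_ofReal hi (ae_of_all _ fun x => ENNReal.toReal_nonneg)]
    exact lintegral_congr fun x => (ENNReal.ofReal_toReal (hfin _)).symm
  obtain ⟨A, hA, hle⟩ := exists_integral_le_add_of_isLawAt_univ hN0 hN hα hτ hρ hh hB
    (ε := ε) (by exact_mod_cast hε)
  have := (hρA A hA).isProbabilityMeasure
  calc _ = ENNReal.ofReal (∫ x, h (N.restrict x) ∂ρ) := hlint ρ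
    _ ≤ ENNReal.ofReal (∫ x, h (N.restrict x) ∂(ρA A) + ε) :=
      ENNReal.ofReal_le_ofReal (hle _ (hρA A hA))
    _ ≤ ENNReal.ofReal (∫ x, h (N.restrict x) ∂(ρA A)) + ε :=
      ENNReal.ofReal_add_le.trans_eq (by rw [ENNReal.ofReal_coe_nnreal])
    _ = ∫⁻ x, min (φ (N.restrict x)) (K : ℝ≥0∞) ∂(ρA A) + ε := by rw [hlint]
    _ ≤ M + ε := by
      gcongr
      exact (lintegral_mono fun x => min_le_left _ _).trans (hM A hA)

open Classical in
/-- The second moment of a sum of centred bounded functions of the patterns. -/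
theorem exists_integral_sq_sum_le (hN0 : 0 ∈ N) (hN : ∀ w ∈ N, -w ∈ N)
    (hα : ∃ c : ℝ≥0, ∀ x, α x Set.univ ≤ c) (hτ : 0 < τ) {ρ : Measure (Lattice d → X)}
    (hρ : IsLawAt N α Set.univ ν τ ρ) {h : (N → X) → ℝ} (hh : Measurable h) {B : ℝ}
    (hB : ∀ y, |h y| ≤ B) (hmean : ∫ x, h (N.restrict x) ∂ρ = 0) {ε : ℝ} (hε : 0 < ε) :
    ∃ C : ℝ, 0 ≤ C ∧ ∀ (A : Finset (Lattice d)) (ρ' : Measure (Lattice d → X)),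
      IsLawAt N α A ν τ ρ' →
      ∫ x, (∑ v ∈ A, h (window N v x)) ^ 2 ∂ρ'
        ≤ ε * A.card ^ 2 + C * ((A + N) \ A).card * A.card + C * A.card := by
  -- Factorisation costs `δ`, and `|m| ≤ δ ≤ 1` gives `m² ≤ δ`; together at most `ε`.
  set δ : ℝ := min (ε / 2) 1
  have hδ : 0 < δ := by positivity
  obtain ⟨R, m, hmc, hmt, hm1, happ⟩ := exists_approx_expectation hN0 hN hα ν hτ N.card (max B 1) hδ
  set f : localAlgebra d X := ofWindow hh hB with hf_def
  have hf := dependsOn_ofWindow (d := d) hh hB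
  have hfB : ∀ x, |f x| ≤ max B 1 := fun x => (hB _).trans (le_max_left _ _)
  have h1 : ∀ x : Lattice d → X, |(1 : localAlgebra d X) x| ≤ max B 1 := fun x => by simp
  have hmf : |m Set.univ f| ≤ δ := by
    have := happ _ ρ hρ N ∅ le_rfl (by simp) f 1 hf (fun _ _ _ => rfl) hfB h1 (by simp)
    simp only [hm1, Subalgebra.coe_one, Pi.one_apply, mul_one] at this
    rwa [show ∫ x, f x ∂ρ = 0 from hmean, zero_sub, abs_neg] at this
  have hsub (v : Lattice d) : thicken N R ({v} + N) = thicken N (R + 1) {v} := rfl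
  -- The first term pays for pairs with either site near the boundary, the second for pairs at most
  -- `2(R + 1)` steps apart.
  refine ⟨2 * B ^ 2 * N.card ^ (R + 1) + B ^ 2 * N.card ^ (R + 1 + (R + 1)), by positivity,
    fun A ρ' hρ' => ?_⟩
  have := hρ'.isProbabilityMeasure
  set D := thicken N (R + 1) ((A + N) \ A)
  -- Off `D`, all sites within `R` steps of the window belong to `A`, so the boundary is invisible.
  have hm_deep : ∀ u ∈ A, u ∉ D → m A (translate u f) = m Set.univ f := by
    intro u hu huD
    rw [hmt]
    refine hmc _ _ N f hf fun v hv => iff_of_true ?_ trivial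
    by_contra hvA
    refine huD (exists_mem_boundary hN0 hN hu (R + 1) ?_ hvA)
    have h0 : ({0} : Finset (Lattice d)) + N = N := zero_add N
    have : v + u ∈ thicken N R (({0} + N) + {u}) := by
      rw [thicken_add_right, h0]
      exact Finset.mem_add.2 ⟨v, hv, u, by simp, rfl⟩
    rwa [add_right_comm, Finset.singleton_add_singleton, zero_add] at this
  have hpair : ∀ u ∈ A, ∀ v ∈ A, ∫ x, h (window N u x) * h (window N v x) ∂ρ'
      ≤ ε + B ^ 2 * ((if u ∈ D then 1 else 0) + (if v ∈ D then 1 else 0)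
        + if v ∈ thicken N (R + 1 + (R + 1)) {u} then 1 else 0) := by
    intro u hu v hv
    have htriv : ∫ x, h (window N u x) * h (window N v x) ∂ρ' ≤ B ^ 2 := by
      have hle : ∀ x : Lattice d → X, ‖h (window N u x) * h (window N v x)‖ ≤ B ^ 2 := fun x => by
        rw [norm_mul, sq]
        exact mul_le_mul (hB _) (hB _) (norm_nonneg _) ((abs_nonneg _).trans (hB (window N u x)))
      have := norm_integral_le_of_norm_le_const (μ := ρ') (ae_of_all _ hle)
      simp only [probReal_univ, mul_one] at this
      exact (le_abs_self _).trans this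
    by_cases huD : u ∈ D
    · refine htriv.trans ?_
      rw [if_pos huD]
      split_ifs <;> nlinarith [sq_nonneg B]
    by_cases hvD : v ∈ D
    · refine htriv.trans ?_
      rw [if_pos hvD]
      split_ifs <;> nlinarith [sq_nonneg B]
    by_cases huv : v ∈ thicken N (R + 1 + (R + 1)) {u}
    · refine htriv.trans ?_
      rw [if_pos huv, if_neg huD, if_neg hvD]
      linarith
    have hdis : Disjoint (thicken N R ({u} + N)) (thicken N R ({v} + N)) := by
      rw [hsub, hsub, Finset.disjoint_left]
      intro z hzu hzv
      exact huv (mem_thicken_trans (mem_thicken_comm hN hzv) hzu)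
    have key := happ _ ρ' hρ' ({u} + N) ({v} + N) (Finset.card_add_le.trans (by simp))
      (Finset.card_add_le.trans (by simp)) (translate u f) (translate v f)
      (dependsOn_translate_ofWindow hh hB u) (dependsOn_translate_ofWindow hh hB v)
      (fun x => hfB _) (fun x => hfB _) hdis
    rw [hm_deep u hu huD, hm_deep v hv hvD] at key
    have h2 : m Set.univ f * m Set.univ f ≤ δ := by
      have : |m Set.univ f| * |m Set.univ f| ≤ δ * 1 :=
        mul_le_mul hmf (hmf.trans (min_le_right _ _)) (abs_nonneg _) hδ.le
      rwa [abs_mul_abs_self, mul_one] at this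
    have h3 := (abs_le.1 key).2
    have h4 : δ ≤ ε / 2 := min_le_left _ _
    rw [if_neg huD, if_neg hvD, if_neg huv]
    change ∫ x, translate u f x * translate v f x ∂ρ' ≤ _
    linarith
  have hint (u v : Lattice d) : Integrable (fun x => h (window N u x) * h (window N v x)) ρ' :=
    localAlgebra.integrable (translate u f * translate v f) ρ'
  have hDcard : (D.card : ℝ) ≤ ((A + N) \ A).card * N.card ^ (R + 1) := by
    exact_mod_cast card_thicken_le (N := N) (R + 1) ((A + N) \ A)
  have hTcard (u : Lattice d) : ((thicken N (R + 1 + (R + 1)) {u}).card : ℝ)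
      ≤ N.card ^ (R + 1 + (R + 1)) := by
    exact_mod_cast (card_thicken_le (N := N) (R + 1 + (R + 1)) {u}).trans (by simp)
  have hcount (T : Finset (Lattice d)) :
      ∑ v ∈ A, (if v ∈ T then 1 else 0 : ℝ) ≤ T.card := by
    rw [Finset.sum_boole]
    exact_mod_cast Finset.card_le_card fun v hv => (Finset.mem_filter.1 hv).2
  calc ∫ x, (∑ v ∈ A, h (window N v x)) ^ 2 ∂ρ'
      = ∑ u ∈ A, ∑ v ∈ A, ∫ x, h (window N u x) * h (window N v x) ∂ρ' := by
        simp only [sq, Finset.sum_mul_sum]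
        rw [integral_finsetSum _ fun u _ => integrable_finsetSum _ fun v _ => hint u v]
        exact Finset.sum_congr rfl fun u _ => integral_finsetSum _ fun v _ => hint u v
    _ ≤ ∑ u ∈ A, ∑ v ∈ A, (ε + B ^ 2 * ((if u ∈ D then 1 else 0) + (if v ∈ D then 1 else 0)
        + if v ∈ thicken N (R + 1 + (R + 1)) {u} then 1 else 0)) :=
      Finset.sum_le_sum fun u hu => Finset.sum_le_sum fun v hv => hpair u hu v hv
    _ = A.card * (A.card * ε) + B ^ 2 * (A.card * (∑ u ∈ A, if u ∈ D then 1 else 0)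
        + A.card * (∑ v ∈ A, if v ∈ D then 1 else 0)
        + ∑ u ∈ A, ∑ v ∈ A, if v ∈ thicken N (R + 1 + (R + 1)) {u} then 1 else 0) := by
      simp only [Finset.sum_add_distrib, Finset.sum_const, nsmul_eq_mul, ← Finset.mul_sum]
    _ ≤ A.card * (A.card * ε)
        + B ^ 2 * (A.card * (((A + N) \ A).card * N.card ^ (R + 1))
        + A.card * (((A + N) \ A).card * N.card ^ (R + 1))
        + A.card * N.card ^ (R + 1 + (R + 1))) := by
      have hD := (hcount D).trans hDcard
      have hT : ∑ u ∈ A, ∑ v ∈ A,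
          (if v ∈ thicken N (R + 1 + (R + 1)) {u} then 1 else 0 : ℝ)
          ≤ A.card * N.card ^ (R + 1 + (R + 1)) := by
        rw [← nsmul_eq_mul]
        exact Finset.sum_le_card_nsmul _ _ _ fun u _ => (hcount _).trans (hTcard u)
      gcongr
    _ ≤ _ := by
      have h5 : (0 : ℝ) ≤ 2 * B ^ 2 * N.card ^ (R + 1) * A.card := by positivity
      have h6 : (0 : ℝ) ≤ B ^ 2 * N.card ^ (R + 1 + (R + 1)) * (((A + N) \ A).card * A.card) := by
        positivity
      nlinarith

end Moments

/-! ### Truncation and moments. -/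

section Truncation

/-- `a`, if `|a| ≤ K`, and zero otherwise. -/
noncomputable def trunc (K a : ℝ) : ℝ := if |a| ≤ K then a else 0

theorem measurable_trunc (K : ℝ) : Measurable (trunc K) :=
  Measurable.ite (measurableSet_le continuous_abs.measurable measurable_const) measurable_id
    measurable_const

theorem abs_trunc_le {K : ℝ} (hK : 0 ≤ K) (a : ℝ) : |trunc K a| ≤ K := by
  unfold trunc
  split_ifs with h
  · exact h
  · simpa using hK

/-- A non-zero difference equals `a` with `|a| > K`, and then `|a|^(1-γ) ≤ K^(1-γ)`. -/
theorem abs_sub_trunc_le {γ K : ℝ} (hγ : 1 ≤ γ) (hK : 0 < K) (a : ℝ) :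
    |a - trunc K a| ≤ K ^ (1 - γ) * |a| ^ γ := by
  unfold trunc
  split_ifs with h
  · rw [sub_self, abs_zero]
    positivity
  · rw [sub_zero]
    have ha : 0 < |a| := hK.trans (not_le.1 h)
    calc |a| = |a| ^ (1 - γ) * |a| ^ γ := by rw [← Real.rpow_add ha]; simp
      _ ≤ _ := by
        gcongr ?_ * _
        exact Real.rpow_le_rpow_of_nonpos hK (not_le.1 h).le (by linarith)

variable {Y : Type*} [MeasurableSpace Y] {ρ : Measure Y} {H : Y → ℝ} {γ : ℝ} {M : ℝ≥0∞}

theorem enorm_rpow_eq_ofReal (hγ : 1 ≤ γ) (a : ℝ) : ‖a‖ₑ ^ γ = ENNReal.ofReal (|a| ^ γ) := by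
  rw [Real.enorm_eq_ofReal_abs, ENNReal.ofReal_rpow_of_nonneg (abs_nonneg _) (by linarith)]

theorem integrable_abs_rpow (hH : Measurable H) (hγ : 1 ≤ γ) (hM : M ≠ ∞)
    (h : ∫⁻ y, ‖H y‖ₑ ^ γ ∂ρ ≤ M) : Integrable (fun y => |H y| ^ γ) ρ := by
  refine ⟨((continuous_abs.measurable.comp hH).pow_const γ).aestronglyMeasurable, ?_⟩
  rw [hasFiniteIntegral_iff_ofReal (ae_of_all _ fun y => by positivity)]
  simp only [enorm_rpow_eq_ofReal hγ] at h
  exact h.trans_lt hM.lt_top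

theorem integrable_of_lintegral_rpow_le [IsFiniteMeasure ρ] (hH : Measurable H) (hγ : 1 ≤ γ)
    (hM : M ≠ ∞) (h : ∫⁻ y, ‖H y‖ₑ ^ γ ∂ρ ≤ M) : Integrable H ρ := by
  refine ((integrable_const (1 : ℝ)).add (integrable_abs_rpow hH hγ hM h)).mono'
    hH.aestronglyMeasurable (ae_of_all _ fun y => ?_)
  have h1 := abs_sub_trunc_le hγ one_pos (H y)
  have h2 := abs_trunc_le zero_le_one (H y)
  rw [Real.one_rpow, one_mul] at h1
  calc |H y| = |trunc 1 (H y) + (H y - trunc 1 (H y))| := by ring_nf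
    _ ≤ 1 + |H y| ^ γ := (abs_add_le _ _).trans (add_le_add h2 h1)

theorem integral_abs_sub_trunc_le [IsFiniteMeasure ρ] (hH : Measurable H) (hγ : 1 ≤ γ)
    (hM : M ≠ ∞) (h : ∫⁻ y, ‖H y‖ₑ ^ γ ∂ρ ≤ M) {K : ℝ} (hK : 0 < K) :
    ∫ y, |H y - trunc K (H y)| ∂ρ ≤ K ^ (1 - γ) * M.toReal := by
  have hi := integrable_abs_rpow hH hγ hM h
  calc _ ≤ ∫ y, K ^ (1 - γ) * |H y| ^ γ ∂ρ :=
        integral_mono_of_nonneg (ae_of_all _ fun _ => abs_nonneg _) (hi.const_mul _)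
          (ae_of_all _ fun y => abs_sub_trunc_le hγ hK (H y))
    _ ≤ _ := by
      rw [integral_const_mul]
      gcongr
      rw [integral_eq_lintegral_of_nonneg_ae (ae_of_all _ fun y => by positivity) hi.1]
      simp only [enorm_rpow_eq_ofReal hγ] at h
      exact ENNReal.toReal_mono hM h

end Truncation

/-! ### The law of large numbers for the averages. -/

section Average

variable {d : ℕ} {X : Type*} [MeasurableSpace X] {N : Finset (Lattice d)}
  {α : Kernel (N → X) (N → X)} {ν : Measure X} [IsProbabilityMeasure ν] {τ : ℝ≥0}
  {H : (N → X) → ℝ} {γ : ℝ} {M : ℝ≥0∞} {ρA : Finset (Lattice d) → Measure (Lattice d → X)}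

/-- Moving the window at `u` to the origin turns `A` into `A - u`, again finite and non-empty. A
bound at the origin for all `A` thus covers all windows. -/
theorem lintegral_window_le (hN0 : 0 ∈ N) (hN : ∀ w ∈ N, -w ∈ N)
    (hα : ∃ c : ℝ≥0, ∀ x, α x Set.univ ≤ c) (hτ : 0 < τ)
    (hρA : ∀ A : Finset (Lattice d), A.Nonempty → IsLawAt N α A ν τ (ρA A))
    {φ : (N → X) → ℝ≥0∞} (hφ : Measurable φ)
    (hM : ∀ A : Finset (Lattice d), A.Nonempty → ∫⁻ x, φ (N.restrict x) ∂(ρA A) ≤ M)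
    {A : Finset (Lattice d)} (hA : A.Nonempty) (u : Lattice d) :
    ∫⁻ x, φ (window N u x) ∂(ρA A) ≤ M := by
  have hA' : (A.image (· - u)).Nonempty := hA.image _
  have hpre : (· + u) ⁻¹' (A : Set (Lattice d)) = (A.image (· - u) : Finset (Lattice d)) := by
    ext v
    simp [sub_eq_iff_eq_add]
  have h := (hρA A hA).map_window_eq hN0 hN hα hτ u (by rw [hpre]; exact hρA _ hA')
  rw [← lintegral_map hφ (measurable_window u), h,
    lintegral_map hφ (Finset.measurable_restrict N)]
  exact hM _ hA'

/-- This passes from second to first moments, in place of the Cauchy-Schwarz inequality. -/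
theorem abs_le_add_sq_div {η : ℝ} (hη : 0 < η) (y : ℝ) : |y| ≤ η + y ^ 2 / η := by
  rw [← sub_le_iff_le_add', le_div_iff₀ hη]
  nlinarith [sq_nonneg (|y| - η), sq_abs y, abs_nonneg y]

/-- The law of large numbers, in terms of the distributions of the processes. -/
theorem eventually_integral_abs_average_sub_le (hN0 : 0 ∈ N) (hN : ∀ w ∈ N, -w ∈ N)
    (hα : ∃ c : ℝ≥0, ∀ x, α x Set.univ ≤ c) (hτ : 0 < τ) {ρ : Measure (Lattice d → X)}
    (hρ : IsLawAt N α Set.univ ν τ ρ)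
    (hρA : ∀ A : Finset (Lattice d), A.Nonempty → IsLawAt N α A ν τ (ρA A))
    (hH : Measurable H) (hγ : 1 < γ) (hM : M ≠ ∞)
    (hmom : ∀ A : Finset (Lattice d), A.Nonempty →
      ∫⁻ x, ‖H (N.restrict x)‖ₑ ^ γ ∂(ρA A) ≤ M)
    {A : ℕ → Finset (Lattice d)} (hA : ∀ n, (A n).Nonempty)
    (hbdry : Tendsto (fun n => (((A n + N) \ A n).card : ℝ) / (A n).card) atTop (𝓝 0))
    (hcard : Tendsto (fun n => (A n).card) atTop atTop) {ε : ℝ} (hε : 0 < ε) :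
    ∀ᶠ n in atTop, ∫ x, |((A n).card : ℝ)⁻¹ * additive N H (A n) x
      - ∫ y, H (N.restrict y) ∂ρ| ∂(ρA (A n)) ≤ ε := by
  have hφ : Measurable fun y => ‖H y‖ₑ ^ γ := hH.enorm.pow_const γ
  have hres : Measurable (N.restrict : (Lattice d → X) → N → X) := Finset.measurable_restrict N
  have := hρ.isProbabilityMeasure
  have hmom' := lintegral_le_of_isLawAt_univ hN0 hN hα hτ hρ hρA hφ hmom
  -- Four errors of size `η`: the two terms of `abs_le_add_sq_div`, and truncation in the finite and
  -- in the infinite system.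
  set η : ℝ := ε / 4 with hη_def
  have hη : 0 < η := by positivity
  have hlim : Tendsto (fun K : ℝ => K ^ (1 - γ) * M.toReal) atTop (𝓝 0) := by
    have := (tendsto_rpow_neg_atTop (y := γ - 1) (by linarith)).mul_const M.toReal
    simpa using this
  -- The truncation errors are uniform in `n`, so `K` is fixed first; the constant `C` below may
  -- depend on it.
  obtain ⟨K, hK, hK0⟩ := ((hlim.eventually (ge_mem_nhds hη)).and (eventually_gt_atTop 0)).exists
  set q : ℝ := ∫ x, trunc K (H (N.restrict x)) ∂ρ with hq
  set c : ℝ := ∫ x, H (N.restrict x) ∂ρ with hc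
  have htm : Measurable fun y => trunc K (H y) := (measurable_trunc K).comp hH
  have hti {π : Measure (Lattice d → X)} [IsProbabilityMeasure π]
      {θ : (Lattice d → X) → N → X} (hθ : Measurable θ) :
      Integrable (fun x => trunc K (H (θ x))) π :=
    .of_bound (htm.comp hθ).aestronglyMeasurable K (ae_of_all _ fun x => abs_trunc_le hK0.le _)
  have hHi' : Integrable (fun x => H (N.restrict x)) ρ :=
    integrable_of_lintegral_rpow_le (hH.comp hres) hγ.le hM hmom'
  have hqc : |q - c| ≤ η := by
    rw [hq, hc, ← integral_sub (hti hres) hHi']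
    refine (abs_integral_le_integral_abs).trans ?_
    simp only [abs_sub_comm (trunc _ _)]
    exact (integral_abs_sub_trunc_le (hH.comp hres) hγ.le hM hmom' hK0).trans hK
  set h : (N → X) → ℝ := fun y => trunc K (H y) - q
  have hh : Measurable h := htm.sub_const q
  have hhB : ∀ y, |h y| ≤ K + |q| := fun y =>
    (abs_sub _ _).trans (add_le_add (abs_trunc_le hK0.le _) le_rfl)
  have hmean : ∫ x, h (N.restrict x) ∂ρ = 0 := by
    simp only [h]
    rw [integral_sub (hti hres) (integrable_const _), ← hq]
    simp
  -- The other half of `η ^ 2` is left for the boundary and diagonal terms, which vanish as `n → ∞`.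
  obtain ⟨C, hC0, hC⟩ := exists_integral_sq_sum_le hN0 hN hα hτ hρ hh hhB hmean
    (ε := η ^ 2 / 2) (by positivity)
  have hlim2 : Tendsto (fun n => C * (((A n + N) \ A n).card / (A n).card)
      + C * ((A n).card : ℝ)⁻¹) atTop (𝓝 0) := by
    have h1 := (hbdry.const_mul C).add
      ((tendsto_inv_atTop_zero.comp (tendsto_natCast_atTop_atTop.comp hcard)).const_mul C)
    simpa using h1
  filter_upwards [hlim2.eventually (ge_mem_nhds (show 0 < η ^ 2 / 2 by positivity))] with n hn
  have hlaw := hρA (A n) (hA n)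
  have := hlaw.isProbabilityMeasure
  have hw (v : Lattice d) := lintegral_window_le hN0 hN hα hτ hρA hφ hmom (hA n) v
  set π := ρA (A n)
  set a : ℝ := ((A n).card : ℝ) with ha_def
  have ha : 0 < a := Nat.cast_pos.2 (hA n).card_pos
  have hsq : ∫ x, (a⁻¹ * ∑ v ∈ A n, h (window N v x)) ^ 2 ∂π ≤ η ^ 2 := by
    simp only [mul_pow]
    rw [integral_const_mul]
    calc _ ≤ a⁻¹ ^ 2 * (η ^ 2 / 2 * a ^ 2 + C * ((A n + N) \ A n).card * a + C * a) := by
          gcongr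
          exact hC (A n) π hlaw
      _ = η ^ 2 / 2 + (C * (((A n + N) \ A n).card / a) + C * a⁻¹) := by
        field_simp
        ring
      _ ≤ _ := by linarith
  have hHi (v : Lattice d) : Integrable (fun x => H (window N v x)) π :=
    integrable_of_lintegral_rpow_le (hH.comp (measurable_window v)) hγ.le hM (hw v)
  have hri (v : Lattice d) :
      Integrable (fun x => |H (window N v x) - trunc K (H (window N v x))|) π :=
    ((hHi v).sub (hti (measurable_window v))).abs
  have hr : ∫ x, a⁻¹ * ∑ v ∈ A n, |H (window N v x) - trunc K (H (window N v x))| ∂π ≤ η := by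
    rw [integral_const_mul, integral_finsetSum _ fun v _ => hri v]
    refine (mul_le_mul_of_nonneg_left (Finset.sum_le_card_nsmul _ _ η fun v _ => ?_)
      (by positivity)).trans_eq (b := a⁻¹ * ((A n).card • η)) ?_
    · exact (integral_abs_sub_trunc_le (hH.comp (measurable_window v)) hγ.le hM (hw v) hK0).trans hK
    · rw [nsmul_eq_mul, ← ha_def, inv_mul_cancel_left₀ ha.ne']
  have hsi : Integrable (fun x => (a⁻¹ * ∑ v ∈ A n, h (window N v x)) ^ 2) π := by
    have e : (fun x => (a⁻¹ * ∑ v ∈ A n, h (window N v x)) ^ 2)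
        = ((a⁻¹ • ∑ v ∈ A n, translate v (ofWindow hh hhB)) ^ 2 : localAlgebra d X) := by
      ext x
      simp only [Subalgebra.coe_pow, Pi.pow_apply, Subalgebra.coe_smul, Pi.smul_apply,
        smul_eq_mul, localAlgebra.sum_apply, translate_ofWindow_apply]
    rw [e]
    exact localAlgebra.integrable _ π
  have hbound : ∀ x, |a⁻¹ * additive N H (A n) x - c|
      ≤ (η + (a⁻¹ * ∑ v ∈ A n, h (window N v x)) ^ 2 / η)
        + a⁻¹ * ∑ v ∈ A n, |H (window N v x) - trunc K (H (window N v x))| + η := by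
    intro x
    have e : a⁻¹ * additive N H (A n) x - c = a⁻¹ * ∑ v ∈ A n, h (window N v x)
        + a⁻¹ * (∑ v ∈ A n, (H (window N v x) - trunc K (H (window N v x)))) + (q - c) := by
      simp only [additive, h, Finset.sum_sub_distrib, Finset.sum_const, nsmul_eq_mul, ← ha_def]
      field_simp
      ring
    rw [e]
    refine (abs_add_three _ _ _).trans (add_le_add_three (abs_le_add_sq_div hη _) ?_ hqc)
    rw [abs_mul, abs_of_pos (inv_pos.2 ha)]
    gcongr
    exact Finset.abs_sum_le_sum_abs _ _
  have hi1 : Integrable (fun x => η + (a⁻¹ * ∑ v ∈ A n, h (window N v x)) ^ 2 / η) π :=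
    (integrable_const η).add (hsi.div_const η)
  have hi2 : Integrable (fun x =>
      a⁻¹ * ∑ v ∈ A n, |H (window N v x) - trunc K (H (window N v x))|) π :=
    (integrable_finsetSum _ fun v _ => hri v).const_mul _
  have hi12 : Integrable (fun x => (η + (a⁻¹ * ∑ v ∈ A n, h (window N v x)) ^ 2 / η)
      + a⁻¹ * ∑ v ∈ A n, |H (window N v x) - trunc K (H (window N v x))|) π := hi1.add hi2
  calc _ ≤ ∫ x, ((η + (a⁻¹ * ∑ v ∈ A n, h (window N v x)) ^ 2 / η)
        + a⁻¹ * ∑ v ∈ A n, |H (window N v x) - trunc K (H (window N v x))| + η) ∂π :=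
      integral_mono_of_nonneg (ae_of_all _ fun _ => abs_nonneg _)
        (hi12.add (integrable_const η)) (ae_of_all _ hbound)
    _ ≤ η + η ^ 2 / η + η + η := by
      rw [integral_add hi12 (integrable_const η), integral_add hi1 hi2,
        integral_add (integrable_const η) (hsi.div_const η), integral_div η]
      simp only [integral_const, probReal_univ, one_smul]
      gcongr
    _ = ε := by
      rw [hη_def]
      field_simp
      ring

/-- The boundary has at least one site, so `1/|A n|` is at most the boundary ratio. -/
theorem tendsto_card_of_boundary (hN0 : 0 ∈ N) (hN1 : N ≠ {0}) {A : ℕ → Finset (Lattice d)}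
    (hA : ∀ n, (A n).Nonempty)
    (hbdry : Tendsto (fun n => (((A n + N) \ A n).card : ℝ) / (A n).card) atTop (𝓝 0)) :
    Tendsto (fun n => (A n).card) atTop atTop := by
  have hpos (n : ℕ) : (0 : ℝ) < ((A n).card : ℝ)⁻¹ :=
    inv_pos.2 (by exact_mod_cast (hA n).card_pos)
  have h0 : Tendsto (fun n => ((A n).card : ℝ)⁻¹) atTop (𝓝[>] 0) := by
    refine tendsto_nhdsWithin_iff.2 ⟨squeeze_zero (fun n => (hpos n).le) (fun n => ?_) hbdry,
      Eventually.of_forall hpos⟩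
    rw [div_eq_mul_inv]
    refine le_mul_of_one_le_left (hpos n).le ?_
    exact_mod_cast (boundary_nonempty hN0 hN1 (hA n)).card_pos
  rw [← tendsto_natCast_atTop_iff (R := ℝ)]
  simpa [Function.comp_def] using tendsto_inv_nhdsGT_zero.comp h0

end Average

end IPS

/-! ### Transfer from the laws to the processes. -/

theorem theorem3p1 {d : ℕ} {X : Type*} [TopologicalSpace X] [PolishSpace X]
    [MeasurableSpace X] [BorelSpace X]
    -- the window `𝒩` and the jump rate kernel on `X^𝒩`, of bounded total measure
    (N : Finset (IPS.Lattice d)) (hN0 : 0 ∈ N) (hNsymm : ∀ w ∈ N, -w ∈ N)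
    (α : Kernel (N → X) (N → X)) (hα : ∃ c : ℝ≥0, ∀ x, α x Set.univ ≤ c)
    (H : (N → X) → ℝ) (hH : Measurable H)
    (ν : Measure X) [IsProbabilityMeasure ν]
    -- the processes `ξ^{A,ν}` for finite nonempty `A`
    {Ω : Finset (IPS.Lattice d) → Type*} [∀ A, MeasurableSpace (Ω A)]
    (P : ∀ A, Measure (Ω A)) [∀ A, IsProbabilityMeasure (P A)]
    (ξ : ∀ A, ℝ≥0 → Ω A → IPS.Lattice d → X)
    (hξ : ∀ A : Finset (IPS.Lattice d), A.Nonempty →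
      IPS.IsRealization N α (A : Set (IPS.Lattice d)) ν (P A) (ξ A))
    -- the process `ξ^ν`
    {Ω' : Type*} [MeasurableSpace Ω'] (P' : Measure Ω') [IsProbabilityMeasure P']
    (ξ' : ℝ≥0 → Ω' → IPS.Lattice d → X)
    (hξ' : IPS.IsRealization N α Set.univ ν P' ξ')
    (τ : ℝ≥0) (hτ : 0 < τ)
    -- the moments condition
    (γ : ℝ) (hγ : 1 < γ)
    (hmom : (⨆ (A : Finset (IPS.Lattice d)) (_ : A.Nonempty),
      ∫⁻ ω, ‖H (N.restrict (ξ A τ ω))‖ₑ ^ γ ∂(P A)) < ∞)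
    -- the sequence of finite nonempty sets
    (A : ℕ → Finset (IPS.Lattice d)) (hA : ∀ n, (A n).Nonempty)
    (hbdry : Tendsto (fun n =>
      ((IPS.extBoundary N (A n : Set (IPS.Lattice d))).ncard : ℝ) / ((A n).card : ℝ))
      atTop (𝓝 0))
    (hinner : ∀ n, IPS.inner N (IPS.nbhdSet N (A n : Set (IPS.Lattice d))) = A n)
    -- in the degenerate case without interaction, boundaries are empty and do not force growth
    (hdeg : N = {0} → Tendsto (fun n => (A n).card) atTop atTop) :
    Integrable (fun ω => H (N.restrict (ξ' τ ω))) P' ∧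
    (∀ n, Integrable (fun ω => ((A n).card : ℝ)⁻¹ * IPS.additive N H (A n) (ξ (A n) τ ω))
      (P (A n))) ∧
    Tendsto (fun n => eLpNorm (fun ω =>
        ((A n).card : ℝ)⁻¹ * IPS.additive N H (A n) (ξ (A n) τ ω)
          - ∫ ω', H (N.restrict (ξ' τ ω')) ∂P') 1 (P (A n)))
      atTop (𝓝 0) := by
  have hres : Measurable (N.restrict : (IPS.Lattice d → X) → N → X) :=
    Finset.measurable_restrict N
  have hφ : Measurable fun y => ‖H y‖ₑ ^ γ := hH.enorm.pow_const γ
  set ρA : Finset (IPS.Lattice d) → Measure (IPS.Lattice d → X) := fun A => (P A).map (ξ A τ)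
  set M : ℝ≥0∞ := ⨆ (A : Finset (IPS.Lattice d)) (_ : A.Nonempty),
    ∫⁻ ω, ‖H (N.restrict (ξ A τ ω))‖ₑ ^ γ ∂(P A)
  have hρ := hξ'.isLawAt τ
  have hρA : ∀ A : Finset (IPS.Lattice d), A.Nonempty → IPS.IsLawAt N α A ν τ (ρA A) :=
    fun A hA => (hξ A hA).isLawAt τ
  have hmom' : ∀ A : Finset (IPS.Lattice d), A.Nonempty →
      ∫⁻ x, ‖H (N.restrict x)‖ₑ ^ γ ∂(ρA A) ≤ M := by
    intro A hA
    have hm : Measurable fun x : IPS.Lattice d → X => ‖H (N.restrict x)‖ₑ ^ γ := hφ.comp hres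
    rw [lintegral_map hm ((hξ A hA).measurable τ)]
    exact le_iSup₂ (f := fun (A : Finset (IPS.Lattice d)) (_ : A.Nonempty) =>
      ∫⁻ ω, ‖H (N.restrict (ξ A τ ω))‖ₑ ^ γ ∂(P A)) A hA
  have hbdry' : Tendsto (fun n => (((A n + N) \ A n).card : ℝ) / (A n).card) atTop (𝓝 0) := by
    refine hbdry.congr fun n => ?_
    rw [IPS.extBoundary_coe, Set.ncard_coe_finset]
  have hcard : Tendsto (fun n => (A n).card) atTop atTop := by
    by_cases hN1 : N = {0}
    · exact hdeg hN1
    · exact IPS.tendsto_card_of_boundary hN0 hN1 hA hbdry'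
  have := hρ.isProbabilityMeasure
  have hξ'm := hξ'.measurable τ
  have hξm (n : ℕ) := (hξ (A n) (hA n)).measurable τ
  have hadd (n : ℕ) : Measurable (IPS.additive N H (A n)) :=
    Finset.measurable_sum _ fun v _ => hH.comp (IPS.measurable_window v)
  have hint (n : ℕ) : Integrable (fun x => ((A n).card : ℝ)⁻¹ * IPS.additive N H (A n) x)
      (ρA (A n)) := by
    have := (hρA (A n) (hA n)).isProbabilityMeasure
    refine (integrable_finsetSum _ fun v _ => ?_).const_mul _
    exact IPS.integrable_of_lintegral_rpow_le (hH.comp (IPS.measurable_window v)) hγ.le hmom.ne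
      (IPS.lintegral_window_le hN0 hNsymm hα hτ hρA hφ hmom' (hA n) v)
  have hint' (n : ℕ) : Integrable (fun ω =>
      ((A n).card : ℝ)⁻¹ * IPS.additive N H (A n) (ξ (A n) τ ω)) (P (A n)) :=
    (hint n).comp_measurable (hξm n)
  have hc : ∫ ω', H (N.restrict (ξ' τ ω')) ∂P'
      = ∫ x, H (N.restrict x) ∂(P'.map (ξ' τ)) :=
    (integral_map hξ'm.aemeasurable (hH.comp hres).aestronglyMeasurable).symm
  refine ⟨?_, hint', ?_⟩
  · have hi := IPS.integrable_of_lintegral_rpow_le (hH.comp hres) hγ.le hmom.ne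
      (IPS.lintegral_le_of_isLawAt_univ hN0 hNsymm hα hτ hρ hρA hφ hmom')
    exact hi.comp_measurable hξ'm
  · have key : Tendsto (fun n => ∫ ω, |((A n).card : ℝ)⁻¹ * IPS.additive N H (A n) (ξ (A n) τ ω)
        - ∫ ω', H (N.restrict (ξ' τ ω')) ∂P'| ∂(P (A n))) atTop (𝓝 0) := by
      refine tendsto_order.2 ⟨fun a ha => Eventually.of_forall fun n =>
        ha.trans_le (integral_nonneg fun _ => abs_nonneg _), fun ε hε => ?_⟩
      filter_upwards [IPS.eventually_integral_abs_average_sub_le hN0 hNsymm hα hτ hρ hρA hH hγ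
        hmom.ne hmom' hA hbdry' hcard (half_pos hε)] with n hn
      rw [← hc, integral_map (hξm n).aemeasurable
        (((hadd n).const_mul _).sub_const _).abs.aestronglyMeasurable] at hn
      exact hn.trans_lt (half_lt_self hε)
    have key' := ENNReal.tendsto_ofReal key
    rw [ENNReal.ofReal_zero] at key'
    refine key'.congr fun n => ?_
    rw [eLpNorm_one_eq_lintegral_enorm]
    exact ofReal_integral_norm_eq_lintegral_enorm ((hint' n).sub (integrable_const _))
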